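/- For integers $d\ge 1$, $n\ge 2$ and a nonempty digit set $\mathcal D\subset\{0,\dots,n-1\}^d$, let $K(n,\mathcal D)\subset\mathbb R^d$ be the fractal cube, that is, the unique nonempty compact set with $$K(n,\mathcal D)=\bigcup_{\delta\in\mathcal D}\frac{K(n,\mathcal D)+\delta}{n},$$ with the Euclidean metric. Metric spaces $(X,d_X)$ and $(Y,d_Y)$ are strictly Hölder equivalent if there are a bijection $f:X\to Y$ and constants $s,C>0$ such that $$C^{-1}d_X(x_1,x_2)^s\le d_Y(f(x_1),f(x_2))\le C\,d_X(x_1,x_2)^s\qquad\text{for all }x_1,x_2\in X.$$ **Theorem 1.1.** Let $d,d'\ge 1$ and $n,n'\ge 2$ be integers, let $\mathcal D\subset\{0,\dots,n-1\}^d$ and $\mathcal D'\subset\{0,\dots,n'-1\}^{d'}$ have cardinalities $N\ge 2$ and $N'\ge 2$, and suppose that $E=K(n,\mathcal D)$ and $F=K(n',\mathcal D')$ are totally disconnected. Then $E$ and $F$ are strictly Hölder equivalent if and only if $$\frac{\log N}{\log N'}\in\mathbb Q.$$ -/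

import Mathlib

/-- `K` is an attractor of the family of maps `φ`: a nonempty compact set with
`K = ⋃ i, φ i '' K`. -/
def IsAttractor {ι X : Type*} [TopologicalSpace X] (φ : ι → X → X) (K : Set X) : Prop :=
  K.Nonempty ∧ IsCompact K ∧ K = ⋃ i, φ i '' K

/-- A nonempty finite family of maps that are contractions (with a common ratio `k < 1`) of a
nonempty complete metric space has exactly one attractor. -/
theorem existsUnique_isAttractor {ι X : Type*} [Finite ι] [Nonempty ι] [MetricSpace X]
    [CompleteSpace X] [Nonempty X] (k : NNReal) (φ : ι → X → X)
    (hφ : ∀ i, ContractingWith k (φ i)) : ∃! K : Set X, IsAttractor φ K := by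
  let H : TopologicalSpace.NonemptyCompacts X → TopologicalSpace.NonemptyCompacts X := fun A =>
    ⟨⟨⋃ i, φ i '' (A : Set X), isCompact_iUnion fun i =>
      A.isCompact.image (hφ i).toLipschitzWith.continuous⟩,
      Set.nonempty_iUnion.2 ⟨Classical.arbitrary ι, A.nonempty.image _⟩⟩
  have hH : ContractingWith k H := by
    refine ⟨(hφ (Classical.arbitrary ι)).1, fun A B => ?_⟩
    have key : ∀ A B : TopologicalSpace.NonemptyCompacts X, ∀ i, ∀ x ∈ φ i '' (A : Set X),
        ∃ y ∈ φ i '' (B : Set X), edist x y ≤ k * edist A B := by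
      rintro A B i _ ⟨a, ha, rfl⟩
      obtain ⟨b, hb, hab⟩ := B.isCompact.exists_infEDist_eq_edist B.nonempty a
      refine ⟨_, ⟨b, hb, rfl⟩, ((hφ i).2 a b).trans ?_⟩
      rw [← hab]
      gcongr
      exact Metric.infEDist_le_hausdorffEDist_of_mem ha
    refine (Metric.hausdorffEDist_iUnion_le (s := fun i => φ i '' (A : Set X))
      (t := fun i => φ i '' (B : Set X))).trans (iSup_le fun i => ?_)
    refine Metric.hausdorffEDist_le_of_mem_edist (key A B i) ?_
    rw [edist_comm A B]
    exact key B A i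
  have : Nonempty (TopologicalSpace.NonemptyCompacts X) := ⟨{Classical.arbitrary X}⟩
  obtain ⟨A, hA⟩ : ∃ A, A = ContractingWith.fixedPoint H hH := ⟨_, rfl⟩
  have hHA : H A = A := hA ▸ hH.fixedPoint_isFixedPt
  refine ⟨A, ⟨A.nonempty, A.isCompact, ?_⟩, ?_⟩
  · exact (congrArg (fun A : TopologicalSpace.NonemptyCompacts X => (A : Set X))
      hHA).symm
  · rintro K ⟨h1, h2, h3⟩
    have hK : Function.IsFixedPt H ⟨⟨K, h2⟩, h1⟩ :=
      TopologicalSpace.NonemptyCompacts.ext h3.symm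
    exact congrArg (fun A : TopologicalSpace.NonemptyCompacts X => (A : Set X))
      ((hH.fixedPoint_unique hK).trans hA.symm)

/-- The map `x ↦ (x + δ) / n` of Euclidean space `ℝ^d`, for a digit `δ ∈ {0, …, n - 1}^d`. -/
noncomputable def cubeMap {d n : ℕ} (δ : Fin d → Fin n) (x : EuclideanSpace ℝ (Fin d)) :
    EuclideanSpace ℝ (Fin d) :=
  (n : ℝ)⁻¹ • (x + WithLp.toLp 2 (fun i => ((δ i : ℕ) : ℝ)))

theorem contractingWith_cubeMap {d n : ℕ} (hn : 2 ≤ n) (δ : Fin d → Fin n) :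
    ContractingWith (n : NNReal)⁻¹ (cubeMap δ) := by
  have hn1 : (1 : NNReal) < n := by exact_mod_cast hn
  refine ⟨inv_lt_one_of_one_lt₀ hn1, LipschitzWith.of_dist_le_mul fun x y => ?_⟩
  rw [cubeMap, cubeMap, dist_smul₀, dist_add_right]
  simp

theorem existsUnique_isAttractor_cubeMap {d n : ℕ} (hn : 2 ≤ n) (D : Finset (Fin d → Fin n))
    (hD : D.Nonempty) :
    ∃! K : Set (EuclideanSpace ℝ (Fin d)),
      IsAttractor (fun δ : D => cubeMap (δ : Fin d → Fin n)) K := by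
  have : Nonempty D := hD.to_subtype
  exact existsUnique_isAttractor (X := EuclideanSpace ℝ (Fin d)) (n : NNReal)⁻¹
    (fun δ : D => cubeMap (δ : Fin d → Fin n)) fun δ => contractingWith_cubeMap hn (δ : Fin d → Fin n)

/-- The fractal cube `K(n, D)` in `ℝ^d`, for `n ≥ 2` and a nonempty digit set
`D ⊆ {0, …, n - 1}^d`: the attractor of the maps `x ↦ (x + δ) / n`, `δ ∈ D`. -/
noncomputable def fractalCube {d n : ℕ} (hn : 2 ≤ n) (D : Finset (Fin d → Fin n))
    (hD : D.Nonempty) : Set (EuclideanSpace ℝ (Fin d)) :=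
  (existsUnique_isAttractor_cubeMap hn D hD).choose

/-- Strict Hölder equivalence of two metric spaces: there is a bijection `f : X → Y` and constants
`s, C > 0` with `C⁻¹ d(x₁, x₂)^s ≤ d(f x₁, f x₂) ≤ C d(x₁, x₂)^s` for all `x₁, x₂`. -/
def StrictlyHolderEquivalent (X Y : Type*) [MetricSpace X] [MetricSpace Y] : Prop :=
  ∃ f : X → Y, Function.Bijective f ∧ ∃ s C : ℝ, 0 < s ∧ 0 < C ∧
    ∀ x₁ x₂ : X, C⁻¹ * dist x₁ x₂ ^ s ≤ dist (f x₁) (f x₂) ∧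
      dist (f x₁) (f x₂) ≤ C * dist x₁ x₂ ^ s

/-!
A totally disconnected fractal cube `E` with `N` digits is coded by the infinite words in `N` letters:
there is a bijection onto these words under which the distance of two points is comparable to
`ρ ^ k`, where `k` is the length of the common initial word (`hasCoding_fractalCube`). Granting
this, the theorem is a statement about words. If `N ^ q = N' ^ p`, grouping letters into blocks of
`q` and `p` letters identifies the two spaces of words up to the choice of the ratio `ρ`, which a
Hölder equivalence can change (`HasCoding.strictlyHolderEquivalent`). Conversely, a Hölder equivalence
distorts the lengths of common initial words linearly, and a comparison of uniform measures at
cylinders where their ratio is nearly maximal yields a relation `N ^ i = N' ^ j`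
(`HasCoding.exists_pow_eq_pow`).

For the coding, `E` is approximated at level `k` by the `N ^ k` lattice points that describe its
cubes of side `n ^ (-k)`, and these are divided into clusters of cubes that are connected by chains
of touching cubes. Finite unions of translates of `E` are again zero-dimensional, so a
cluster cannot leave the neighbourhood of a cube of somewhat larger size (`exists_cluster_bound`).
Hence there are finitely many clusters up to translation, the level `k` clusters have diameter
comparable to `n ^ (-k)`, and they are separated by distances of at least `n ^ (-k)`.

The tree of clusters is matched with the tree of words by matching a cluster with a bounded
number `b` of words that have a common ancestor one level up (`TypedTree.exists_matching`). To pass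
to the next level, the subclusters have to be distributed among the `b` words, with numbers of
matched words that add up to the exact number of extensions at each of the `b` words. Such a packing
exists as soon as the numbers that occur often have greatest common divisor `1` (`exists_packing`).
Let the weight of a cluster be its number of cubes. For clusters of terminal type, from whose
descendants one can return to the type, the weights divided by their greatest common divisor have
this property, so these reduced weights, and their multiples by a power of `N`, are
admissible numbers. Numbers in between are made admissible by letting the density of the matching
vary among the subclusters. This flexibility of terminal clusters, which occur below any cluster,
absorbs the divisibility constraints at the remaining clusters, whose density is kept constant.
-/

/-! ### Packing integers into bins -/

theorem exists_subset_sum_close {ι : Type*} (s : ι → ℕ) (B : ℕ) (I : Finset ι)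
    (hB : ∀ i ∈ I, s i ≤ B) (t : ℕ) (ht : t ≤ ∑ i ∈ I, s i) :
    ∃ J ⊆ I, ∑ i ∈ J, s i ≤ t ∧ t ≤ ∑ i ∈ J, s i + B := by
  classical
  induction I using Finset.induction_on with
  | empty => exact ⟨∅, by simp, by simp, by simp at ht; simp [ht]⟩
  | insert a I ha ih =>
    by_cases h : t ≤ ∑ i ∈ I, s i
    · obtain ⟨J, hJ, h1, h2⟩ := ih (fun i hi => hB i (Finset.mem_insert_of_mem hi)) h
      exact ⟨J, hJ.trans (Finset.subset_insert _ _), h1, h2⟩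
    · rw [Finset.sum_insert ha] at ht
      have := hB a (Finset.mem_insert_self _ _)
      exact ⟨I, Finset.subset_insert _ _, by omega, by omega⟩

theorem exists_subset_of_multiset {ι : Type*} [DecidableEq ι] (s : ι → ℕ) (I : Finset ι) (k : ℕ)
    (l : Multiset ℕ) (h : ∀ z ∈ l, k ≤ {i ∈ I | s i = z}.card) (hk : l.card ≤ k) :
    ∃ J ⊆ I, J.card = l.card ∧ ∑ i ∈ J, s i = l.sum := by
  induction l using Multiset.induction_on with
  | empty => exact ⟨∅, by simp⟩
  | cons z l ih =>
    rw [Multiset.card_cons] at hk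
    obtain ⟨J, hJ, h1, h2⟩ := ih (fun z hz => h z (Multiset.mem_cons_of_mem hz)) (by omega)
    have hz := h z (Multiset.mem_cons_self _ _)
    obtain ⟨i, hi, hiJ⟩ : ∃ i ∈ {i ∈ I | s i = z}, i ∉ J :=
      Finset.exists_mem_notMem_of_card_lt_card (by omega)
    rw [Finset.mem_filter] at hi
    refine ⟨insert i J, Finset.insert_subset hi.1 hJ, ?_, ?_⟩
    · rw [Finset.card_insert_of_notMem hiJ, h1, Multiset.card_cons]
    · rw [Finset.sum_insert hiJ, h2, hi.2, Multiset.sum_cons]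

/-- All large integers are sums of elements of `Z`, with a threshold depending only on a bound for
`Z`. -/
theorem exists_forall_mem_closure (B : ℕ) : ∃ F : ℕ, ∀ Z : Finset ℕ, Z ⊆ Finset.Icc 1 B →
    Nat.setGcd (Z : Set ℕ) = 1 → ∀ x, F ≤ x → x ∈ AddSubmonoid.closure (Z : Set ℕ) := by
  choose F hF using fun Z : Finset ℕ => Nat.exists_mem_closure_of_ge (Z : Set ℕ)
  refine ⟨(Finset.Icc 1 B).powerset.sup F, fun Z hZ hg x hx => hF Z x ?_ (by simp [hg])⟩
  exact (Finset.le_sup (f := F) (Finset.mem_powerset.2 hZ)).trans hx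

/-- One bin of capacity `C` is filled exactly, and every size in `Z` stays frequent among
the remaining items: a greedy choice among unreserved items nearly fills the bin, and reserved items
with sizes in `Z` make up the difference. -/
theorem exists_fill_bin (B : ℕ) : ∃ R C₀ : ℕ, ∀ {ι : Type*} [DecidableEq ι] (I : Finset ι)
    (s : ι → ℕ) (C b : ℕ) (Z : Finset ℕ), (∀ i ∈ I, 1 ≤ s i ∧ s i ≤ B) → Z ⊆ Finset.Icc 1 B →
    Nat.setGcd (Z : Set ℕ) = 1 → (∀ z ∈ Z, (b + 1) * R ≤ {i ∈ I | s i = z}.card) →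
    C₀ ≤ C → ∑ i ∈ I, s i = (b + 1) * C →
    ∃ J ⊆ I, ∑ i ∈ J, s i = C ∧ ∀ z ∈ Z, b * R ≤ {i ∈ I \ J | s i = z}.card := by
  obtain ⟨F, hF⟩ := exists_forall_mem_closure B
  refine ⟨F + B, 2 * (F + B) * B ^ 2 + F, ?_⟩
  intro ι _ I s C b Z hs hZ hg hR hC hsum
  rcases Nat.eq_zero_or_pos b with rfl | hb
  · exact ⟨I, subset_rfl, by simpa using hsum, by simp⟩
  set R := F + B with hRdef
  choose! P hPsub hPcard using fun z (hz : z ∈ Z) => Finset.exists_subset_card_eq (hR z hz)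
  set Res := Z.biUnion P with hRes
  have hResI : Res ⊆ I := by
    intro i hi
    obtain ⟨z, hz, hiz⟩ := Finset.mem_biUnion.1 hi
    exact (Finset.mem_filter.1 (hPsub z hz hiz)).1
  have hZB : Z.card ≤ B := by simpa using Finset.card_le_card hZ
  have hRescard : Res.card ≤ B * ((b + 1) * R) :=
    (Finset.card_biUnion_le_card_mul _ _ _ fun z hz => (hPcard z hz).le).trans
      (Nat.mul_le_mul_right _ hZB)
  have hRessum : ∑ i ∈ Res, s i ≤ B * ((b + 1) * R) * B := by
    refine (Finset.sum_le_card_nsmul _ _ B fun i hi => (hs i (hResI hi)).2).trans ?_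
    simpa using Nat.mul_le_mul_right B hRescard
  have hsplit : ∑ i ∈ I \ Res, s i + ∑ i ∈ Res, s i = (b + 1) * C := by
    rw [Finset.sum_sdiff hResI, hsum]
  have hlarge : C - F ≤ ∑ i ∈ I \ Res, s i := by
    have h1 : B * ((b + 1) * R) * B = (b + 1) * (R * B ^ 2) := by ring
    have h2 : 2 * ((b + 1) * (R * B ^ 2)) ≤ (b + 1) * C := by
      calc 2 * ((b + 1) * (R * B ^ 2)) = (b + 1) * (2 * R * B ^ 2) := by ring
        _ ≤ (b + 1) * C := Nat.mul_le_mul_left _ (by omega)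
    have h3 : 2 * C ≤ (b + 1) * C := Nat.mul_le_mul_right _ (by omega)
    omega
  obtain ⟨J₁, hJ₁, h1, h2⟩ := exists_subset_sum_close s B (I \ Res)
    (fun i hi => (hs i (Finset.sdiff_subset hi)).2) (C - F) hlarge
  have hFC : F ≤ C := by omega
  obtain ⟨l, hl, hlsum⟩ := AddSubmonoid.exists_multiset_of_mem_closure
    (hF Z hZ hg (C - ∑ i ∈ J₁, s i) (by omega))
  have hlcard : l.card ≤ R := by
    have : l.card • 1 ≤ l.sum := Multiset.card_nsmul_le_sum fun z hz =>
      (Finset.mem_Icc.1 (hZ (hl z hz))).1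
    simp only [smul_eq_mul, mul_one] at this
    omega
  have hResR : ∀ z ∈ Z, (b + 1) * R ≤ {i ∈ Res | s i = z}.card := by
    intro z hz
    rw [← hPcard z hz]
    refine Finset.card_le_card fun i hi => Finset.mem_filter.2
      ⟨Finset.mem_biUnion.2 ⟨z, hz, hi⟩, (Finset.mem_filter.1 (hPsub z hz hi)).2⟩
  obtain ⟨J₂, hJ₂, h3, h4⟩ := exists_subset_of_multiset s Res R l
    (fun z hz => le_trans (Nat.le_mul_of_pos_left _ (by omega)) (hResR z (hl z hz))) hlcard
  have hdisj : Disjoint J₁ J₂ := Finset.disjoint_of_subset_left hJ₁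
    (Finset.disjoint_of_subset_right hJ₂ Finset.sdiff_disjoint)
  refine ⟨J₁ ∪ J₂, Finset.union_subset (hJ₁.trans Finset.sdiff_subset) (hJ₂.trans hResI), ?_, ?_⟩
  · rw [Finset.sum_union hdisj, h4, hlsum]
    omega
  · intro z hz
    have hsub : {i ∈ Res | s i = z} \ J₂ ⊆ {i ∈ I \ (J₁ ∪ J₂) | s i = z} := by
      intro i hi
      simp only [Finset.mem_sdiff, Finset.mem_filter, Finset.mem_union, not_or] at hi ⊢
      refine ⟨⟨hResI hi.1.1, fun h => ?_, hi.2⟩, hi.1.2⟩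
      exact (Finset.mem_sdiff.1 (hJ₁ h)).2 hi.1.1
    have h5 := Finset.card_le_card hsub
    have h6 := Finset.le_card_sdiff J₂ {i ∈ Res | s i = z}
    have h7 := hResR z hz
    have h8 : (b + 1) * R = b * R + R := by ring
    omega

/-- Items of sizes at most `B` and total size `b * C` fill `b` bins of capacity `C` exactly, as soon
as the sizes that occur often have greatest common divisor `1` and `C` is large. -/
theorem exists_packing (B : ℕ) : ∃ R C₀ : ℕ, ∀ {ι : Type*} (I : Finset ι)
    (s : ι → ℕ) (C b : ℕ) (Z : Finset ℕ), (∀ i ∈ I, 1 ≤ s i ∧ s i ≤ B) → Z ⊆ Finset.Icc 1 B →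
    Nat.setGcd (Z : Set ℕ) = 1 → (∀ z ∈ Z, b * R ≤ {i ∈ I | s i = z}.card) →
    C₀ ≤ C → ∑ i ∈ I, s i = b * C →
    ∃ f : ι → ℕ, (∀ i ∈ I, f i < b) ∧ ∀ j < b, ∑ i ∈ I with f i = j, s i = C := by
  obtain ⟨R, C₀, h⟩ := exists_fill_bin B
  refine ⟨R, C₀, ?_⟩
  intro ι I s C b Z hs hZ hg hR hC hsum
  classical
  induction b generalizing I with
  | zero =>
    refine ⟨fun _ => 0, fun i hi => ?_, by simp⟩
    have := (Finset.sum_eq_zero_iff.1 (hsum.trans (zero_mul C))) i hi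
    have := (hs i hi).1
    omega
  | succ b ih =>
    obtain ⟨J, hJ, hJsum, hJR⟩ := h I s C b Z hs hZ hg hR hC hsum
    obtain ⟨f, hf, hfsum⟩ := ih (I \ J) (fun i hi => hs i (Finset.sdiff_subset hi)) hJR (by
      have := Finset.sum_sdiff (f := s) hJ
      rw [hsum, hJsum, add_mul, one_mul] at this
      omega)
    refine ⟨fun i => if i ∈ J then b else f i, fun i hi => ?_, fun j hj => ?_⟩
    · by_cases hiJ : i ∈ J
      · simp [hiJ]
      · simpa [hiJ] using (hf i (by simp [hi, hiJ])).trans (Nat.lt_succ_self b)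
    · rcases Nat.lt_succ_iff_lt_or_eq.1 hj with hj | rfl
      · rw [← hfsum j hj]
        refine Finset.sum_congr ?_ fun _ _ => rfl
        ext i
        simp only [Finset.mem_filter, Finset.mem_sdiff]
        by_cases hiJ : i ∈ J
        · simp [hiJ, hj.ne']
        · simp [hiJ]
      · rw [← hJsum]
        refine Finset.sum_congr ?_ fun _ _ => rfl
        ext i
        simp only [Finset.mem_filter]
        by_cases hiJ : i ∈ J
        · simp [hiJ, hJ hiJ]
        · simp only [hiJ, if_false, iff_false, not_and]
          intro hi
          exact (hf i (by simp [hi, hiJ])).ne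

/-- A discrete intermediate value theorem for sums. -/
theorem exists_sum_eq_of_le_of_le {ι : Type*} (I : Finset ι) (l h : ι → ℕ)
    (hlh : ∀ i ∈ I, l i ≤ h i) (t : ℕ) (hl : ∑ i ∈ I, l i ≤ t) (hh : t ≤ ∑ i ∈ I, h i) :
    ∃ s : ι → ℕ, (∀ i ∈ I, l i ≤ s i ∧ s i ≤ h i) ∧ ∑ i ∈ I, s i = t := by
  classical
  induction I using Finset.induction_on generalizing t with
  | empty => exact ⟨l, by simp, by simp at hh ⊢; omega⟩
  | insert a I ha ih =>
    rw [Finset.sum_insert ha] at hl hh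
    have h1 := hlh a (Finset.mem_insert_self _ _)
    have hne : ∀ i ∈ I, i ≠ a := fun i hi h => ha (h ▸ hi)
    have h2 : ∑ i ∈ I, l i ≤ ∑ i ∈ I, h i :=
      Finset.sum_le_sum fun i hi => hlh i (Finset.mem_insert_of_mem hi)
    obtain ⟨s, hs, hsum⟩ := ih (fun i hi => hlh i (Finset.mem_insert_of_mem hi))
      (max (∑ i ∈ I, l i) (t - h a)) (le_max_left _ _) (by omega)
    refine ⟨Function.update s a (t - max (∑ i ∈ I, l i) (t - h a)), ?_, ?_⟩
    · intro i hi
      rcases Finset.mem_insert.1 hi with rfl | hi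
      · simp only [Function.update_self]
        omega
      · rw [Function.update_of_ne (hne i hi)]
        exact hs i hi
    · rw [Finset.sum_insert ha, Function.update_self,
        Finset.sum_congr rfl fun i hi => Function.update_of_ne (hne i hi) _ _,
        hsum]
      omega

/-! ### Weighted trees with finitely many types -/

/-- A combinatorial tree of clusters. Every vertex `v` has finitely many children `ch v`, a type
`ty v` and a weight `wt v ∈ {1, …, M}`; the weights of the children add up to `N * wt v`, and the type
determines the weight and the types of the children. The relation `apart` records that two vertices
have no common descendants. The axioms are only required on the vertices satisfying `good`. -/
structure TypedTree (V K : Type*) (N M : ℕ) where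
  ch : V → Finset V
  ty : V → K
  wt : V → ℕ
  good : V → Prop
  apart : V → V → Prop
  good_ch : ∀ {v v'}, good v → v' ∈ ch v → good v'
  wt_pos : ∀ {v}, good v → 1 ≤ wt v
  wt_le : ∀ {v}, good v → wt v ≤ M
  sum_wt : ∀ {v}, good v → ∑ v' ∈ ch v, wt v' = N * wt v
  wt_congr : ∀ {v w}, good v → good w → ty v = ty w → wt v = wt w
  ch_congr : ∀ {v w v'}, good v → good w → ty v = ty w → v' ∈ ch v → ∃ w' ∈ ch w, ty w' = ty v'
  apart_irrefl : ∀ {v}, good v → ¬ apart v v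
  apart_ch : ∀ {v w v' w'}, apart v w → v' ∈ ch v → w' ∈ ch w → apart v' w'
  apart_of_mem_ch : ∀ {v v' v''}, good v → v' ∈ ch v → v'' ∈ ch v → v' ≠ v'' → apart v' v''

/-- The descendants of `v`, `m` generations down. -/
noncomputable def descendants {V : Type*} (ch : V → Finset V) : ℕ → V → Finset V
  | 0, v => {v}
  | m + 1, v => by classical exact (descendants ch m v).biUnion ch

theorem mem_descendants_zero {V : Type*} {ch : V → Finset V} {v u : V} :
    u ∈ descendants ch 0 v ↔ u = v := by
  rw [descendants, Finset.mem_singleton]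

theorem mem_descendants_succ {V : Type*} {ch : V → Finset V} {m : ℕ} {v u : V} :
    u ∈ descendants ch (m + 1) v ↔ ∃ w ∈ descendants ch m v, u ∈ ch w := by
  classical
  simp only [descendants, Finset.mem_biUnion]

theorem mem_descendants_add {V : Type*} {ch : V → Finset V} {m k : ℕ} {v u : V} :
    u ∈ descendants ch (m + k) v ↔ ∃ w ∈ descendants ch m v, u ∈ descendants ch k w := by
  induction k generalizing u with
  | zero => simp [mem_descendants_zero]
  | succ k ih =>
    rw [← add_assoc, mem_descendants_succ]
    simp only [mem_descendants_succ, ih]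
    constructor
    · rintro ⟨w, ⟨x, hx, hw⟩, hu⟩
      exact ⟨x, hx, w, hw, hu⟩
    · rintro ⟨x, hx, w, hw, hu⟩
      exact ⟨w, ⟨x, hx, hw⟩, hu⟩

namespace TypedTree

variable {V K : Type*} {N M : ℕ} (T : TypedTree V K N M)

theorem good_descendants {m : ℕ} {v u : V} (hv : T.good v) (hu : u ∈ descendants T.ch m v) :
    T.good u := by
  induction m generalizing u with
  | zero => rw [mem_descendants_zero] at hu; exact hu ▸ hv
  | succ m ih =>
    obtain ⟨w, hw, hu⟩ := mem_descendants_succ.1 hu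
    exact T.good_ch (ih hw) hu

theorem apart_descendants {m : ℕ} {v w v' w' : V} (h : T.apart v w)
    (hv : v' ∈ descendants T.ch m v) (hw : w' ∈ descendants T.ch m w) : T.apart v' w' := by
  induction m generalizing v' w' with
  | zero =>
    rw [mem_descendants_zero] at hv hw
    rwa [hv, hw]
  | succ m ih =>
    obtain ⟨x, hx, hv⟩ := mem_descendants_succ.1 hv
    obtain ⟨y, hy, hw⟩ := mem_descendants_succ.1 hw
    exact T.apart_ch (ih hx hy) hv hw

theorem apart_of_mem_descendants {m : ℕ} {v x y : V} (hv : T.good v)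
    (hx : x ∈ descendants T.ch m v) (hy : y ∈ descendants T.ch m v) (hxy : x ≠ y) :
    T.apart x y := by
  induction m generalizing x y with
  | zero =>
    rw [mem_descendants_zero] at hx hy
    exact absurd (hx.trans hy.symm) hxy
  | succ m ih =>
    obtain ⟨x', hx', hx⟩ := mem_descendants_succ.1 hx
    obtain ⟨y', hy', hy⟩ := mem_descendants_succ.1 hy
    by_cases h : x' = y'
    · subst h
      exact T.apart_of_mem_ch (T.good_descendants hv hx') hx hy hxy
    · exact T.apart_ch (ih hx' hy' h) hx hy

theorem sum_wt_descendants (m : ℕ) {v : V} (hv : T.good v) :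
    ∑ u ∈ descendants T.ch m v, T.wt u = N ^ m * T.wt v := by
  classical
  induction m with
  | zero => simp [descendants]
  | succ m ih =>
    rw [descendants, Finset.sum_biUnion]
    · rw [Finset.sum_congr rfl fun u hu => T.sum_wt (T.good_descendants hv hu), ← Finset.mul_sum,
        ih]
      ring
    · intro x hx y hy hxy
      refine Finset.disjoint_left.2 fun u hux huy => ?_
      exact T.apart_irrefl (T.good_ch (T.good_descendants hv hx) hux)
        (T.apart_ch (T.apart_of_mem_descendants hv hx hy hxy) hux huy)

theorem descendants_congr {m : ℕ} {v w u : V} (hv : T.good v) (hw : T.good w)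
    (h : T.ty v = T.ty w) (hu : u ∈ descendants T.ch m v) :
    ∃ x ∈ descendants T.ch m w, T.ty x = T.ty u := by
  induction m generalizing u with
  | zero =>
    rw [mem_descendants_zero] at hu
    exact ⟨w, mem_descendants_zero.2 rfl, by rw [hu, h]⟩
  | succ m ih =>
    obtain ⟨u', hu', hu⟩ := mem_descendants_succ.1 hu
    obtain ⟨x', hx', hx'u⟩ := ih hu'
    obtain ⟨x, hx, hxu⟩ := T.ch_congr (T.good_descendants hv hu') (T.good_descendants hw hx')
      hx'u.symm hu
    exact ⟨x, mem_descendants_succ.2 ⟨x', hx', hx⟩, hxu⟩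

theorem pow_le_card_descendants (m : ℕ) {v : V} (hv : T.good v) :
    N ^ m ≤ (descendants T.ch m v).card * M := by
  have h1 := T.sum_wt_descendants m hv
  have h2 := Finset.sum_le_card_nsmul (descendants T.ch m v) T.wt M
    fun u hu => T.wt_le (T.good_descendants hv hu)
  rw [h1, smul_eq_mul] at h2
  exact (Nat.le_mul_of_pos_right _ (T.wt_pos hv)).trans h2

/-- `T.reach m κ κ'`: a vertex of type `κ` has a descendant of type `κ'`, `m` generations down. -/
def reach (m : ℕ) (κ κ' : K) : Prop :=
  ∃ v, T.good v ∧ T.ty v = κ ∧ ∃ u ∈ descendants T.ch m v, T.ty u = κ'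

theorem reach_ty {m : ℕ} {v : V} (hv : T.good v) {κ : K} (h : T.reach m (T.ty v) κ) :
    ∃ u ∈ descendants T.ch m v, T.ty u = κ := by
  obtain ⟨w, hw, hwv, u, hu, rfl⟩ := h
  exact T.descendants_congr hw hv hwv hu

theorem reach_add {m k : ℕ} {κ κ' : K} :
    T.reach (m + k) κ κ' ↔ ∃ κ'', T.reach m κ κ'' ∧ T.reach k κ'' κ' := by
  constructor
  · rintro ⟨v, hv, hκ, u, hu, hκ'⟩
    obtain ⟨w, hw, hu⟩ := mem_descendants_add.1 hu
    exact ⟨T.ty w, ⟨v, hv, hκ, w, hw, rfl⟩, w, T.good_descendants hv hw, rfl, u, hu, hκ'⟩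
  · rintro ⟨κ'', ⟨v, hv, hκ, w, hw, rfl⟩, h⟩
    obtain ⟨u, hu, hκ'⟩ := T.reach_ty (T.good_descendants hv hw) h
    exact ⟨v, hv, hκ, u, mem_descendants_add.2 ⟨w, hw, hu⟩, hκ'⟩

theorem reach_add_congr {i j : ℕ} (h : T.reach i = T.reach j) (k : ℕ) :
    T.reach (i + k) = T.reach (j + k) := by
  ext κ κ'
  rw [T.reach_add, T.reach_add, h]

/-- Some power of the reachability relation is idempotent. -/
theorem exists_reach_idempotent [Finite K] :
    ∃ c, 1 ≤ c ∧ ∀ t, T.reach (c * (t + 1)) = T.reach c := by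
  obtain ⟨i, j, hij, h⟩ := Finite.exists_ne_map_eq_of_infinite fun m => T.reach m
  wlog hlt : i < j generalizing i j
  · exact this j i hij.symm h.symm (by omega)
  obtain ⟨p, rfl⟩ := Nat.exists_eq_add_of_lt hlt
  have hper : ∀ k s, T.reach (i + k + (p + 1) * s) = T.reach (i + k) := by
    intro k s
    induction s with
    | zero => simp
    | succ s ih =>
      rw [← ih, show i + k + (p + 1) * (s + 1) = i + p + 1 + (k + (p + 1) * s) by ring,
        show i + k + (p + 1) * s = i + (k + (p + 1) * s) by ring]
      exact T.reach_add_congr h.symm _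
  refine ⟨(p + 1) * (i + 1), Nat.mul_pos (by omega) (by omega), fun t => ?_⟩
  have h1 := hper (p * (i + 1) + 1) ((i + 1) * t)
  rwa [show i + (p * (i + 1) + 1) + (p + 1) * ((i + 1) * t) = (p + 1) * (i + 1) * (t + 1) by ring,
    show i + (p * (i + 1) + 1) = (p + 1) * (i + 1) by ring] at h1

/-- If every `k`-th generation descendant of `v` has a descendant of type `κ`, `c` generations down,
then `v` has many descendants of type `κ`. -/
theorem pow_le_card_filter_ty {k c : ℕ} {v : V} {κ : K} (hv : T.good v)
    (h : ∀ u ∈ descendants T.ch k v, T.reach c (T.ty u) κ) [DecidableEq K] :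
    N ^ k ≤ {u ∈ descendants T.ch (k + c) v | T.ty u = κ}.card * M := by
  refine (T.pow_le_card_descendants k hv).trans (Nat.mul_le_mul_right _ ?_)
  choose! F hF hFκ using fun u hu => T.reach_ty (T.good_descendants hv hu) (h u hu)
  refine Finset.card_le_card_of_injOn F (fun u hu => ?_) fun u hu w hw huw => ?_
  · exact Finset.mem_coe.2
      (Finset.mem_filter.2 ⟨mem_descendants_add.2 ⟨u, hu, hF u hu⟩, hFκ u hu⟩)
  · by_contra hne
    have := T.apart_descendants (T.apart_of_mem_descendants hv hu hw hne) (hF u hu) (hF w hw)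
    rw [← huw] at this
    exact T.apart_irrefl (T.good_descendants (T.good_descendants hv hu) (hF u hu)) this

/-- A type is terminal if it can be reached back, in `c` generations, from all types that it reaches
in `c` generations. -/
def Terminal (c : ℕ) (κ : K) : Prop :=
  ∀ κ', T.reach c κ κ' → T.reach c κ' κ

variable {T} {c : ℕ}

theorem reach_trans (hc : ∀ t, T.reach (c * (t + 1)) = T.reach c) {κ₁ κ₂ κ₃ : K}
    (h₁ : T.reach c κ₁ κ₂) (h₂ : T.reach c κ₂ κ₃) : T.reach c κ₁ κ₃ := by
  have h := hc 1
  rw [show c * (1 + 1) = c + c by ring] at h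
  rw [← h]
  exact T.reach_add.2 ⟨κ₂, h₁, h₂⟩

theorem exists_reach (hN : 0 < N) (m : ℕ) {v : V} (hv : T.good v) :
    ∃ κ, T.reach m (T.ty v) κ := by
  have h := T.pow_le_card_descendants m hv
  have h1 : 0 < N ^ m := pow_pos hN m
  obtain ⟨u, hu⟩ := Finset.card_pos.1 (Nat.pos_of_mul_pos_right (h1.trans_le h))
  exact ⟨T.ty u, v, hv, rfl, u, hu, rfl⟩

theorem reach_self (hc : ∀ t, T.reach (c * (t + 1)) = T.reach c) (hN : 0 < N) {v : V}
    (hv : T.good v) (ht : T.Terminal c (T.ty v)) : T.reach c (T.ty v) (T.ty v) := by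
  obtain ⟨κ, hκ⟩ := exists_reach hN c hv
  exact reach_trans hc hκ (ht κ hκ)

theorem Terminal.of_reach (hc : ∀ t, T.reach (c * (t + 1)) = T.reach c) {κ κ' : K}
    (h : T.Terminal c κ) (hκ : T.reach c κ κ') : T.Terminal c κ' := fun _ h' =>
  reach_trans hc (h _ (reach_trans hc hκ h')) hκ

theorem Terminal.reach_iff (hc : ∀ t, T.reach (c * (t + 1)) = T.reach c) {κ κ' : K}
    (h : T.Terminal c κ) (hκ : T.reach c κ κ') (κ'' : K) : T.reach c κ' κ'' ↔ T.reach c κ κ'' :=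
  ⟨fun h' => reach_trans hc hκ h', fun h' => reach_trans hc (h _ hκ) h'⟩

theorem exists_terminal (hc : ∀ t, T.reach (c * (t + 1)) = T.reach c) (hN : 0 < N) [Finite K]
    {v : V} (hv : T.good v) : ∃ κ, T.reach c (T.ty v) κ ∧ T.Terminal c κ := by
  obtain ⟨κ, hκ, hmin⟩ := Set.exists_min_image {κ | T.reach c (T.ty v) κ}
    (fun κ => {κ' | T.reach c κ κ'}.ncard) (Set.toFinite _) (exists_reach hN c hv)
  have heq : ∀ κ', T.reach c κ κ' → {κ'' | T.reach c κ' κ''} = {κ'' | T.reach c κ κ''} :=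
    fun κ' h => Set.eq_of_subset_of_ncard_le (fun κ'' h' => reach_trans hc h h')
      (hmin κ' (reach_trans hc hκ h)) (Set.toFinite _)
  obtain ⟨u, hu, hκu⟩ := T.reach_ty hv hκ
  obtain ⟨κ', hκ'⟩ := exists_reach hN c (T.good_descendants hv hu)
  rw [hκu] at hκ'
  refine ⟨κ', reach_trans hc hκ hκ', fun κ'' h => ?_⟩
  have h1 : T.reach c κ κ'' := reach_trans hc hκ' h
  have h2 : κ' ∈ {κ₃ | T.reach c κ'' κ₃} := by
    rw [heq κ'' h1]
    exact hκ'
  exact h2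

variable (T c) in
/-- The greatest common divisor of the weights of the vertices whose types are reached from the
type of `v`. -/
noncomputable def wtGcd (v : V) : ℕ :=
  Nat.setGcd {a | ∃ w, T.good w ∧ T.reach c (T.ty v) (T.ty w) ∧ T.wt w = a}

theorem wtGcd_dvd {v w : V} (hw : T.good w) (h : T.reach c (T.ty v) (T.ty w)) :
    T.wtGcd c v ∣ T.wt w :=
  Nat.setGcd_dvd_of_mem ⟨w, hw, h, rfl⟩

theorem wtGcd_congr (hc : ∀ t, T.reach (c * (t + 1)) = T.reach c) {v w : V}
    (ht : T.Terminal c (T.ty v)) (h : T.reach c (T.ty v) (T.ty w)) :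
    T.wtGcd c w = T.wtGcd c v := by
  simp only [wtGcd, ht.reach_iff hc h]

theorem wtGcd_pos (hN : 0 < N) {v : V} (hv : T.good v) : 0 < T.wtGcd c v := by
  obtain ⟨κ, hκ⟩ := exists_reach hN c hv
  obtain ⟨u, hu, rfl⟩ := T.reach_ty hv hκ
  have hu' := T.good_descendants hv hu
  exact Nat.pos_of_dvd_of_pos (wtGcd_dvd hu' hκ) (T.wt_pos hu')

variable (T c) in
/-- The weights of the vertices whose types are reached from the type of `v`, divided by their
greatest common divisor. -/
noncomputable def sizes (v : V) : Finset ℕ := by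
  classical exact {z ∈ Finset.Icc 1 M |
    ∃ w, T.good w ∧ T.reach c (T.ty v) (T.ty w) ∧ T.wt w = T.wtGcd c v * z}

theorem mem_sizes {v : V} {z : ℕ} : z ∈ T.sizes c v ↔ z ∈ Finset.Icc 1 M ∧
    ∃ w, T.good w ∧ T.reach c (T.ty v) (T.ty w) ∧ T.wt w = T.wtGcd c v * z := by
  classical
  rw [sizes, Finset.mem_filter]

theorem setGcd_sizes (hN : 0 < N) {v : V} (hv : T.good v) :
    Nat.setGcd (T.sizes c v : Set ℕ) = 1 := by
  have hpos := wtGcd_pos (c := c) hN hv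
  have h : T.wtGcd c v * Nat.setGcd (T.sizes c v : Set ℕ) ∣ T.wtGcd c v := by
    refine Nat.dvd_setGcd_iff.2 ?_
    rintro _ ⟨w, hw, hr, rfl⟩
    obtain ⟨z, hz⟩ := wtGcd_dvd hw hr
    rw [hz]
    refine mul_dvd_mul_left _ (Nat.setGcd_dvd_of_mem (Finset.mem_coe.2 (mem_sizes.2 ?_)))
    have h1 := T.wt_pos hw
    have h2 := T.wt_le hw
    rw [hz] at h1 h2
    exact ⟨Finset.mem_Icc.2 ⟨Nat.pos_of_mul_pos_left h1,
      (Nat.le_mul_of_pos_left _ hpos).trans h2⟩, w, hw, hr, hz⟩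
  have h' : Nat.setGcd (T.sizes c v : Set ℕ) ∣ 1 :=
    Nat.dvd_of_mul_dvd_mul_left hpos (by simpa using h)
  exact Nat.dvd_one.1 h'

end TypedTree

/-! ### Matching a tree of clusters with a tree of words -/

theorem setGcd_eq_one_of_consecutive {Z : Set ℕ} {z : ℕ} (h : z ∈ Z) (h' : z + 1 ∈ Z) :
    Nat.setGcd Z = 1 :=
  Nat.dvd_one.1 ((Nat.dvd_add_right (Nat.setGcd_dvd_of_mem h)).1 (Nat.setGcd_dvd_of_mem h'))

theorem exists_disjoint_subsets {ι : Type*} (I : Finset ι) (R : ℕ) (h : 3 * R ≤ I.card) :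
    ∃ P ⊆ I, ∃ Q ⊆ I, Disjoint P Q ∧ P.card = R ∧ Q.card = R ∧
      ∃ S ⊆ I, S.card = R ∧ Disjoint P S ∧ Disjoint Q S := by
  classical
  obtain ⟨P, hP, hPR⟩ := Finset.exists_subset_card_eq (show R ≤ I.card by omega)
  have h1 := Finset.card_sdiff_add_card_eq_card hP
  obtain ⟨Q, hQ, hQR⟩ := Finset.exists_subset_card_eq (show R ≤ (I \ P).card by omega)
  have h2 := Finset.card_sdiff_add_card_eq_card hQ
  obtain ⟨S, hS, hSR⟩ := Finset.exists_subset_card_eq (show R ≤ ((I \ P) \ Q).card by omega)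
  refine ⟨P, hP, Q, hQ.trans Finset.sdiff_subset, ?_, hPR, hQR, S,
    hS.trans (Finset.sdiff_subset.trans Finset.sdiff_subset), hSR, ?_, ?_⟩
  · exact Finset.disjoint_of_subset_right hQ Finset.disjoint_sdiff
  · exact Finset.disjoint_of_subset_right (hS.trans Finset.sdiff_subset) Finset.disjoint_sdiff
  · exact Finset.disjoint_of_subset_right hS Finset.disjoint_sdiff

/-- The conclusion of `exists_packing`, for items in `V`. -/
def PackingBound (V : Type*) (B R C₀ : ℕ) : Prop :=
  ∀ (I : Finset V) (s : V → ℕ) (C b : ℕ) (Z : Finset ℕ), (∀ i ∈ I, 1 ≤ s i ∧ s i ≤ B) →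
    Z ⊆ Finset.Icc 1 B → Nat.setGcd (Z : Set ℕ) = 1 →
    (∀ z ∈ Z, b * R ≤ {i ∈ I | s i = z}.card) → C₀ ≤ C → ∑ i ∈ I, s i = b * C →
    ∃ f : V → ℕ, (∀ i ∈ I, f i < b) ∧ ∀ j < b, ∑ i ∈ I with f i = j, s i = C

namespace TypedTree

variable {V K : Type*} {N M : ℕ} {T : TypedTree V K N M} {c : ℕ}

variable (T c) in
/-- The weight of `v` divided by the greatest common divisor `T.wtGcd c v`. -/
noncomputable def redWt (v : V) : ℕ := T.wt v / T.wtGcd c v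

theorem wtGcd_mul_redWt (hc : ∀ t, T.reach (c * (t + 1)) = T.reach c) (hN : 0 < N) {v : V}
    (hv : T.good v) (ht : T.Terminal c (T.ty v)) : T.wtGcd c v * T.redWt c v = T.wt v :=
  Nat.mul_div_cancel' (wtGcd_dvd hv (reach_self hc hN hv ht))

theorem redWt_pos (hc : ∀ t, T.reach (c * (t + 1)) = T.reach c) (hN : 0 < N) {v : V}
    (hv : T.good v) (ht : T.Terminal c (T.ty v)) : 1 ≤ T.redWt c v := by
  have h := T.wt_pos hv
  rw [← wtGcd_mul_redWt hc hN hv ht] at h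
  exact Nat.pos_of_mul_pos_left h

theorem redWt_le_wt (v : V) : T.redWt c v ≤ T.wt v := Nat.div_le_self _ _

theorem reach_of_mem_descendants {m : ℕ} (hm : T.reach m = T.reach c) {v u : V} (hv : T.good v)
    (hu : u ∈ descendants T.ch m v) : T.reach c (T.ty v) (T.ty u) := by
  rw [← hm]
  exact ⟨v, hv, rfl, u, hu, rfl⟩

theorem sum_redWt (hc : ∀ t, T.reach (c * (t + 1)) = T.reach c) (hN : 0 < N) {m : ℕ}
    (hm : T.reach m = T.reach c) {v : V} (hv : T.good v) (ht : T.Terminal c (T.ty v)) :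
    ∑ u ∈ descendants T.ch m v, T.redWt c u = N ^ m * T.redWt c v := by
  refine Nat.eq_of_mul_eq_mul_left (wtGcd_pos (c := c) hN hv) ?_
  rw [Finset.mul_sum, mul_left_comm, wtGcd_mul_redWt hc hN hv ht, ← T.sum_wt_descendants m hv]
  refine Finset.sum_congr rfl fun u hu => ?_
  have hr := reach_of_mem_descendants hm hv hu
  rw [← wtGcd_congr hc ht hr]
  exact wtGcd_mul_redWt hc hN (T.good_descendants hv hu) (ht.of_reach hc hr)

variable {B R C₀ : ℕ}

/-- Below a terminal vertex the reduced weights themselves can be packed. -/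
theorem exists_packing_redWt (hc : ∀ t, T.reach (c * (t + 1)) = T.reach c) (hN : 0 < N)
    (hpack : PackingBound V B R C₀) (hMB : M ≤ B) {m : ℕ} (hm : T.reach m = T.reach c)
    {v : V} (hv : T.good v) (ht : T.Terminal c (T.ty v)) [DecidableEq K] {b C : ℕ}
    (hmult : ∀ κ, T.reach c (T.ty v) κ → b * R ≤ {u ∈ descendants T.ch m v | T.ty u = κ}.card)
    (hC : C₀ ≤ C) (hb : N ^ m * T.redWt c v = b * C) :
    ∃ f : V → ℕ, (∀ u ∈ descendants T.ch m v, f u < b) ∧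
      ∀ j < b, ∑ u ∈ descendants T.ch m v with f u = j, T.redWt c u = C := by
  refine hpack _ _ C b (T.sizes c v) (fun u hu => ?_) (fun z hz => ?_) (setGcd_sizes hN hv)
    (fun z hz => ?_) hC ((sum_redWt hc hN hm hv ht).trans hb)
  · have hu' := T.good_descendants hv hu
    exact ⟨redWt_pos hc hN hu' (ht.of_reach hc (reach_of_mem_descendants hm hv hu)),
      (redWt_le_wt u).trans ((T.wt_le hu').trans hMB)⟩
  · exact Finset.Icc_subset_Icc_right hMB (mem_sizes.1 hz).1
  · obtain ⟨-, w, hw, hr, hwz⟩ := mem_sizes.1 hz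
    refine (hmult _ hr).trans (Finset.card_le_card fun u hu => ?_)
    rw [Finset.mem_filter] at hu ⊢
    refine ⟨hu.1, ?_⟩
    have hu' := T.good_descendants hv hu.1
    rw [redWt, T.wt_congr hu' hw hu.2, hwz,
      wtGcd_congr hc ht (reach_of_mem_descendants hm hv hu.1)]
    exact Nat.mul_div_cancel_left z (wtGcd_pos hN hv)

/-- Below a terminal vertex `v`, packings with `b` bins exist for every `b` strictly between the
reduced weight of `v` and `L` times this weight, with the sizes in the corresponding range. -/
theorem exists_packing_between (hc : ∀ t, T.reach (c * (t + 1)) = T.reach c) (hN : 0 < N)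
    (hpack : PackingBound V B R C₀) {m L R' : ℕ} (hL : 2 ≤ L) (hB : L * M ≤ B)
    (hm : T.reach m = T.reach c) {v : V} (hv : T.good v) (ht : T.Terminal c (T.ty v))
    [DecidableEq K] {b : ℕ} (hb₁ : T.redWt c v < b) (hb₂ : b < L * T.redWt c v)
    (hbR : b * R ≤ R') (hmult : 3 * R' ≤ {u ∈ descendants T.ch m v | T.ty u = T.ty v}.card)
    (hC : C₀ ≤ N ^ m) (hR' : 2 * R' * (L * M) ≤ N ^ m) :
    ∃ f s : V → ℕ, (∀ u ∈ descendants T.ch m v, f u < b ∧ T.redWt c u ≤ s u ∧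
        s u ≤ L * T.redWt c u) ∧
      ∀ j < b, ∑ u ∈ descendants T.ch m v with f u = j, s u = N ^ m := by
  classical
  obtain ⟨P, hP, Q, hQ, hPQ, hPR, hQR, -⟩ := exists_disjoint_subsets _ R' hmult
  set I := descendants T.ch m v with hI
  have hgood : ∀ u ∈ I, T.good u := fun u hu => T.good_descendants hv hu
  have hreach : ∀ u ∈ I, T.reach c (T.ty v) (T.ty u) := fun u hu =>
    reach_of_mem_descendants hm hv hu
  have hpos : ∀ u ∈ I, 1 ≤ T.redWt c u := fun u hu =>
    redWt_pos hc hN (hgood u hu) (ht.of_reach hc (hreach u hu))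
  have hM : ∀ u ∈ I, T.redWt c u ≤ M := fun u hu => (redWt_le_wt u).trans (T.wt_le (hgood u hu))
  have hred : ∀ u ∈ I, T.ty u = T.ty v → T.redWt c u = T.redWt c v := fun u hu h => by
    rw [redWt, redWt, T.wt_congr (hgood u hu) hv h, wtGcd_congr hc ht (hreach u hu)]
  have hPI : P ⊆ I := hP.trans (Finset.filter_subset _ _)
  have hQI : Q ⊆ I := hQ.trans (Finset.filter_subset _ _)
  let l : V → ℕ := fun u => if u ∈ P then T.redWt c u else
    if u ∈ Q then T.redWt c u + 1 else T.redWt c u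
  let h : V → ℕ := fun u => if u ∈ P then T.redWt c u else
    if u ∈ Q then T.redWt c u + 1 else L * T.redWt c u
  have hLle : ∀ u, 2 * T.redWt c u ≤ L * T.redWt c u := fun u => Nat.mul_le_mul_right _ hL
  have hsum := sum_redWt hc hN hm hv ht
  rw [← hI] at hsum
  have hb₃ : N ^ m * T.redWt c v + N ^ m ≤ b * N ^ m := by
    calc N ^ m * T.redWt c v + N ^ m = (T.redWt c v + 1) * N ^ m := by ring
      _ ≤ b * N ^ m := Nat.mul_le_mul_right _ hb₁
  have hb₄ : b * N ^ m + N ^ m ≤ L * (N ^ m * T.redWt c v) := by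
    calc b * N ^ m + N ^ m = (b + 1) * N ^ m := by ring
      _ ≤ L * T.redWt c v * N ^ m := Nat.mul_le_mul_right _ hb₂
      _ = L * (N ^ m * T.redWt c v) := by ring
  have hMpos : 1 ≤ M := (T.wt_pos hv).trans (T.wt_le hv)
  have hR'N : R' ≤ N ^ m := by
    refine le_trans ?_ hR'
    calc R' ≤ R' * (2 * (L * M)) :=
          Nat.le_mul_of_pos_right _ (Nat.mul_pos two_pos (Nat.mul_pos (by omega) hMpos))
      _ = 2 * R' * (L * M) := by ring
  obtain ⟨s, hs, hssum⟩ := exists_sum_eq_of_le_of_le I l h (fun u hu => by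
      have := hLle u
      simp only [l, h]
      split_ifs <;> omega) (b * N ^ m) (by
      have h1 : ∀ u ∈ I, l u ≤ T.redWt c u + if u ∈ Q then 1 else 0 := fun u hu => by
        simp only [l]
        split_ifs <;> omega
      refine (Finset.sum_le_sum h1).trans ?_
      rw [Finset.sum_add_distrib, hsum, Finset.sum_ite_mem, Finset.inter_eq_right.2 hQI,
        Finset.sum_const, smul_eq_mul, mul_one, hQR]
      omega) (by
      have h1 : ∀ u ∈ I, L * T.redWt c u ≤ h u + if u ∈ P ∪ Q then L * M else 0 := fun u hu => by
        have := Nat.mul_le_mul_left L (hM u hu)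
        simp only [h, Finset.mem_union]
        by_cases hP : u ∈ P
        · simp only [hP, if_true, true_or]
          omega
        · by_cases hQ : u ∈ Q
          · simp only [hP, hQ, if_true, or_true, if_false]
            omega
          · simp [hP, hQ]
      have h2 := Finset.sum_le_sum h1
      rw [← Finset.mul_sum, hsum, Finset.sum_add_distrib, Finset.sum_ite_mem,
        Finset.inter_eq_right.2 (Finset.union_subset hPI hQI), Finset.sum_const, smul_eq_mul,
        Finset.card_union_of_disjoint hPQ, hPR, hQR, ← two_mul] at h2
      omega)
  have hsl : ∀ u ∈ I, T.redWt c u ≤ s u ∧ s u ≤ L * T.redWt c u := fun u hu => by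
    have h1 := hs u hu
    have h2 := hLle u
    have h3 := hpos u hu
    simp only [l, h] at h1
    split_ifs at h1 <;> omega
  have hsP : ∀ u ∈ P, s u = T.redWt c v := fun u hu => by
    have h1 := hs u (hPI hu)
    simp only [l, h, hu, if_true] at h1
    rw [← hred u (hPI hu) (Finset.mem_filter.1 (hP hu)).2]
    omega
  have hsQ : ∀ u ∈ Q, s u = T.redWt c v + 1 := fun u hu => by
    have h1 := hs u (hQI hu)
    simp only [l, h, hu, if_true, Finset.disjoint_right.1 hPQ hu, if_false] at h1
    rw [← hred u (hQI hu) (Finset.mem_filter.1 (hQ hu)).2]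
    omega
  have hvpos := redWt_pos hc hN hv ht
  have hvB : T.redWt c v + 1 ≤ B := by
    have := hLle v
    have := Nat.mul_le_mul_left L ((redWt_le_wt (c := c) v).trans (T.wt_le hv))
    omega
  obtain ⟨f, hf, hfsum⟩ := hpack I s (N ^ m) b {T.redWt c v, T.redWt c v + 1}
    (fun u hu => ⟨(hpos u hu).trans (hsl u hu).1,
      (hsl u hu).2.trans ((Nat.mul_le_mul_left L (hM u hu)).trans hB)⟩)
    (fun z hz => by
      simp only [Finset.mem_insert, Finset.mem_singleton] at hz
      rw [Finset.mem_Icc]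
      omega)
    (setGcd_eq_one_of_consecutive (z := T.redWt c v) (by simp) (by simp))
    (fun z hz => by
      simp only [Finset.mem_insert, Finset.mem_singleton] at hz
      rcases hz with rfl | rfl
      · rw [← hPR] at hbR
        exact hbR.trans (Finset.card_le_card fun u hu => Finset.mem_filter.2 ⟨hPI hu, hsP u hu⟩)
      · rw [← hQR] at hbR
        exact hbR.trans (Finset.card_le_card fun u hu => Finset.mem_filter.2 ⟨hQI hu, hsQ u hu⟩))
    hC hssum
  exact ⟨f, s, fun u hu => ⟨hf u hu, hsl u hu⟩, hfsum⟩

/-- Below any vertex `v`, the weights multiplied by `N` can be packed after changes by at most `1`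
at the vertices of one type `κ` that occurs often. -/
theorem exists_packing_perturb (hpack : PackingBound V B R C₀) (hN : 2 ≤ N) {m R' : ℕ}
    (hB : N * M + 1 ≤ B) {v : V} (hv : T.good v) [DecidableEq K] {κ : K}
    (hκ : T.reach m (T.ty v) κ) (hbR : N * T.wt v * R ≤ R')
    (hmult : 3 * R' ≤ {u ∈ descendants T.ch m v | T.ty u = κ}.card) (hC : C₀ ≤ N ^ m) :
    ∃ f s : V → ℕ, (∀ u ∈ descendants T.ch m v, f u < N * T.wt v ∧
        (T.ty u ≠ κ → s u = N * T.wt u) ∧ N * T.wt u - 1 ≤ s u ∧ s u ≤ N * T.wt u + 1) ∧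
      ∀ j < N * T.wt v, ∑ u ∈ descendants T.ch m v with f u = j, s u = N ^ m := by
  classical
  obtain ⟨P, hP, Q, hQ, hPQ, hPR, hQR, S, hS, hSR, hPS, hQS⟩ := exists_disjoint_subsets _ R' hmult
  set I := descendants T.ch m v with hI
  have hgood : ∀ u ∈ I, T.good u := fun u hu => T.good_descendants hv hu
  have hPI : P ⊆ I := hP.trans (Finset.filter_subset _ _)
  have hQI : Q ⊆ I := hQ.trans (Finset.filter_subset _ _)
  have hSI : S ⊆ I := hS.trans (Finset.filter_subset _ _)
  obtain ⟨w, hwI, hwκ⟩ := T.reach_ty hv hκ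
  have hw := T.good_descendants hv hwI
  have hwt : ∀ u ∈ I, T.ty u = κ → T.wt u = T.wt w := fun u hu h =>
    T.wt_congr (hgood u hu) hw (h.trans hwκ.symm)
  have hNwt : ∀ u ∈ I, 2 ≤ N * T.wt u ∧ N * T.wt u ≤ N * M := fun u hu =>
    ⟨hN.trans (Nat.le_mul_of_pos_right _ (T.wt_pos (hgood u hu))),
      Nat.mul_le_mul_left _ (T.wt_le (hgood u hu))⟩
  let s : V → ℕ := fun u => if u ∈ P then N * T.wt u - 1 else
    if u ∈ Q then N * T.wt u + 1 else N * T.wt u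
  have hssum : ∑ u ∈ I, s u = N * T.wt v * N ^ m := by
    have h1 : ∀ u ∈ I, s u + (if u ∈ P then 1 else 0) = N * T.wt u + if u ∈ Q then 1 else 0 :=
      fun u hu => by
        have h2 := hNwt u hu
        by_cases hP : u ∈ P
        · simp only [s, hP, if_true, Finset.disjoint_left.1 hPQ hP, if_false]
          omega
        · simp only [s, hP, if_false]
          split_ifs <;> omega
    have h2 := Finset.sum_congr rfl h1
    rw [Finset.sum_add_distrib, Finset.sum_add_distrib, Finset.sum_ite_mem, Finset.sum_ite_mem,
      Finset.inter_eq_right.2 hPI, Finset.inter_eq_right.2 hQI, Finset.sum_const, Finset.sum_const,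
      hPR, hQR, ← Finset.mul_sum, hI, T.sum_wt_descendants m hv] at h2
    rw [hI, Nat.add_right_cancel h2]
    ring
  have hs : ∀ u ∈ I, N * T.wt u - 1 ≤ s u ∧ s u ≤ N * T.wt u + 1 := fun u hu => by
    simp only [s]
    split_ifs <;> omega
  have hsP : ∀ u ∈ P, s u = N * T.wt w - 1 := fun u hu => by
    simp only [s, hu, if_true]
    rw [hwt u (hPI hu) (Finset.mem_filter.1 (hP hu)).2]
  have hsS : ∀ u ∈ S, s u = N * T.wt w := fun u hu => by
    simp only [s, Finset.disjoint_right.1 hPS hu, Finset.disjoint_right.1 hQS hu, if_false]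
    rw [hwt u (hSI hu) (Finset.mem_filter.1 (hS hu)).2]
  have hw2 := hNwt w hwI
  obtain ⟨f, hf, hfsum⟩ := hpack I s (N ^ m) (N * T.wt v) {N * T.wt w - 1, N * T.wt w}
    (fun u hu => by
      have h1 := hs u hu
      have h2 := hNwt u hu
      omega)
    (fun z hz => by
      simp only [Finset.mem_insert, Finset.mem_singleton] at hz
      rw [Finset.mem_Icc]
      omega)
    (setGcd_eq_one_of_consecutive (z := N * T.wt w - 1) (by simp)
      (by rw [Nat.sub_add_cancel (by omega)]; simp))
    (fun z hz => by
      simp only [Finset.mem_insert, Finset.mem_singleton] at hz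
      rcases hz with rfl | rfl
      · rw [← hPR] at hbR
        exact hbR.trans (Finset.card_le_card fun u hu => Finset.mem_filter.2 ⟨hPI hu, hsP u hu⟩)
      · rw [← hSR] at hbR
        exact hbR.trans (Finset.card_le_card fun u hu => Finset.mem_filter.2 ⟨hSI hu, hsS u hu⟩))
    hC hssum
  refine ⟨f, s, fun u hu => ⟨hf u hu, fun hne => ?_, hs u hu⟩, hfsum⟩
  have h1 : u ∉ P := fun h => hne (Finset.mem_filter.1 (hP h)).2
  have h2 : u ∉ Q := fun h => hne (Finset.mem_filter.1 (hQ h)).2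
  simp only [s, h1, h2, if_false]

/-- The number of symbolic cylinders to be matched with a vertex. A vertex of non-terminal type is
matched with `N * wt v` cylinders; for a vertex of terminal type every number between the reduced
weight and `L` times the reduced weight is allowed. -/
def Admissible (T : TypedTree V K N M) (c L : ℕ) (v : V) (b : ℕ) : Prop :=
  (¬ T.Terminal c (T.ty v) ∧ b = N * T.wt v) ∨
    (T.Terminal c (T.ty v) ∧ T.redWt c v ≤ b ∧ b ≤ L * T.redWt c v)

theorem admissible_of_near (hc : ∀ t, T.reach (c * (t + 1)) = T.reach c) (hN : 2 ≤ N) {L : ℕ}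
    (hL : N * M + 1 ≤ L) {v : V} (hv : T.good v) {b : ℕ}
    (hb : ¬ T.Terminal c (T.ty v) → b = N * T.wt v) (hb₁ : N * T.wt v - 1 ≤ b)
    (hb₂ : b ≤ N * T.wt v + 1) : T.Admissible c L v b := by
  by_cases ht : T.Terminal c (T.ty v)
  · refine Or.inr ⟨ht, ?_, hb₂.trans ?_⟩
    · have h1 := redWt_le_wt (T := T) (c := c) v
      have h2 := Nat.mul_le_mul_right (T.wt v) hN
      have h3 := T.wt_pos hv
      omega
    · have h1 := wtGcd_mul_redWt hc (by omega) hv ht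
      have h2 := redWt_pos hc (by omega) hv ht
      have h3 : T.wtGcd c v ≤ M := by
        refine le_trans ?_ (T.wt_le hv)
        rw [← h1]
        exact Nat.le_mul_of_pos_right _ h2
      calc N * T.wt v + 1 = N * T.wtGcd c v * T.redWt c v + 1 := by rw [← h1]; ring
        _ ≤ N * M * T.redWt c v + T.redWt c v :=
            Nat.add_le_add (Nat.mul_le_mul_right _ (Nat.mul_le_mul_left _ h3)) h2
        _ = (N * M + 1) * T.redWt c v := by ring
        _ ≤ L * T.redWt c v := Nat.mul_le_mul_right _ hL
  · exact Or.inl ⟨ht, hb ht⟩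

/-- A tree with finitely many types can be matched with the tree of words in an alphabet of `N ^ m`
letters: for suitable `m ≥ 1`, a vertex matched with `b` words can have its descendants, `m`
generations down, distributed among these words and matched with numbers of extensions by one letter
that add up to `N ^ m` for each word. -/
theorem exists_matching [Finite K] (T : TypedTree V K N M) (hN : 2 ≤ N) :
    ∃ m, 1 ≤ m ∧ ∃ A : V → ℕ → Prop, (∀ v, T.good v → T.wt v = 1 → A v N) ∧
      ∀ v b, T.good v → A v b → ∃ f s : V → ℕ,
        (∀ u ∈ descendants T.ch m v, f u < b ∧ 1 ≤ s u ∧ A u (s u)) ∧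
        ∀ j < b, ∑ u ∈ descendants T.ch m v with f u = j, s u = N ^ m := by
  classical
  have hN0 : 0 < N := by omega
  obtain ⟨c, hc1, hc⟩ := T.exists_reach_idempotent
  set e := N * M + 1 with he
  set L := N ^ e with hLdef
  have hL : N * M + 1 ≤ L := (Nat.lt_pow_self hN).le
  obtain ⟨R, C₀, hpack'⟩ := exists_packing (L * M)
  have hpack : PackingBound V (L * M) R C₀ := fun I s C b Z => hpack' I s C b Z
  set R' := L * M * R with hR'
  set t := 2 + e + C₀ + 2 * R' * (L * M) + 3 * R' * M with ht
  set m := c * (t + 1) with hm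
  have hmr : T.reach m = T.reach c := hc t
  have htm : t + 1 ≤ m := Nat.le_mul_of_pos_left _ hc1
  have hpow : ∀ x y, x ≤ y → x ≤ N ^ y := fun x y h => h.trans (Nat.lt_pow_self hN).le
  have hmany : ∀ v κ, T.good v → T.reach c (T.ty v) κ → T.Terminal c κ →
      3 * R' ≤ {u ∈ descendants T.ch m v | T.ty u = κ}.card := by
    intro v κ hv hκ hterm
    obtain ⟨w, hw, hwκ⟩ := T.reach_ty hv hκ
    have hwg := T.good_descendants hv hw
    obtain ⟨t', ht'⟩ : ∃ t', t = t' + 2 := ⟨t - 2, by omega⟩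
    have h1 : N ^ (c * (t' + 1)) ≤
        {u ∈ descendants T.ch (c * (t' + 1) + c) w | T.ty u = κ}.card * M := by
      refine T.pow_le_card_filter_ty hwg fun u hu => ?_
      have h2 : T.reach (c * (t' + 1)) κ (T.ty u) := hwκ ▸ ⟨w, hwg, rfl, u, hu, rfl⟩
      rw [hc] at h2
      exact hterm _ h2
    have h2 : 3 * R' * M ≤ N ^ (c * (t' + 1)) := by
      refine hpow _ _ (le_trans ?_ (Nat.le_mul_of_pos_left (t' + 1) hc1))
      omega
    have h3 : {u ∈ descendants T.ch (c * (t' + 1) + c) w | T.ty u = κ}.card ≤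
        {u ∈ descendants T.ch m v | T.ty u = κ}.card := by
      refine Finset.card_le_card fun u hu => ?_
      rw [Finset.mem_filter] at hu ⊢
      refine ⟨?_, hu.2⟩
      rw [hm, ht', show c * (t' + 2 + 1) = c + (c * (t' + 1) + c) by ring]
      exact mem_descendants_add.2 ⟨w, hw, hu.1⟩
    exact (Nat.le_of_mul_le_mul_right (h2.trans h1)
      ((T.wt_pos hv).trans (T.wt_le hv))).trans h3
  have hadm : ∀ v b, T.good v → T.Admissible c L v b → b ≤ L * M := by
    rintro v b hv (⟨-, rfl⟩ | ⟨-, -, h⟩)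
    · exact Nat.mul_le_mul (by rw [hLdef]; exact Nat.le_self_pow (by omega) N) (T.wt_le hv)
    · exact h.trans (Nat.mul_le_mul_left _ ((redWt_le_wt v).trans (T.wt_le hv)))
  refine ⟨m, by omega, T.Admissible c L, fun v hv h1 => ?_, fun v b hv hb => ?_⟩
  · refine admissible_of_near hc hN hL hv (fun _ => by simp [h1]) ?_ ?_ <;> rw [h1] <;> omega
  have hbR : b * R ≤ R' := Nat.mul_le_mul_right _ (hadm v b hv hb)
  have hMpos : 1 ≤ M := (T.wt_pos hv).trans (T.wt_le hv)
  have hLM : L ≤ L * M := Nat.le_mul_of_pos_right _ hMpos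
  have hML : M ≤ L * M := Nat.le_mul_of_pos_left _ (by omega)
  have hNM : 2 ≤ N * M := hN.trans (Nat.le_mul_of_pos_right _ hMpos)
  rcases hb with ⟨hnt, rfl⟩ | ⟨hterm, hb₁, hb₂⟩
  · obtain ⟨κ, hκ, hκt⟩ := exists_terminal hc hN0 hv
    obtain ⟨f, s, hfs, hsum⟩ := exists_packing_perturb (m := m) hpack hN (hL.trans hLM) hv
      (hmr ▸ hκ) hbR (hmany v κ hv hκ hκt) (hpow _ _ (by omega))
    refine ⟨f, s, fun u hu => ?_, hsum⟩
    obtain ⟨h1, h2, h3, h4⟩ := hfs u hu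
    have hug := T.good_descendants hv hu
    have h5 := hN.trans (Nat.le_mul_of_pos_right N (T.wt_pos hug))
    exact ⟨h1, by omega, admissible_of_near hc hN hL hug
      (fun hnt => h2 fun h => hnt (h ▸ hκt)) h3 h4⟩
  have hgr : ∀ u ∈ descendants T.ch m v, T.Terminal c (T.ty u) ∧ 1 ≤ T.redWt c u := fun u hu =>
    have h := hterm.of_reach hc (reach_of_mem_descendants hmr hv hu)
    ⟨h, redWt_pos hc hN0 (T.good_descendants hv hu) h⟩
  have hmult : ∀ κ, T.reach c (T.ty v) κ →
      b * R ≤ {u ∈ descendants T.ch m v | T.ty u = κ}.card := fun κ hκ =>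
    hbR.trans (le_trans (by omega) (hmany v κ hv hκ (hterm.of_reach hc hκ)))
  rcases hb₁.eq_or_lt with rfl | hb₁
  · obtain ⟨f, hf, hsum⟩ := exists_packing_redWt hc hN0 hpack hML hmr hv hterm hmult
      (C := N ^ m) (hpow _ _ (by omega)) (mul_comm _ _)
    refine ⟨f, T.redWt c, fun u hu => ⟨hf u hu, (hgr u hu).2, Or.inr ⟨(hgr u hu).1, le_rfl, ?_⟩⟩,
      hsum⟩
    exact Nat.le_mul_of_pos_left _ (by omega)
  rcases hb₂.eq_or_lt with rfl | hb₂
  · have hme : N ^ m = L * N ^ (m - e) := by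
      rw [hLdef, ← pow_add]
      congr 1
      omega
    obtain ⟨f, hf, hsum⟩ := exists_packing_redWt hc hN0 hpack hML hmr hv hterm hmult
      (C := N ^ (m - e)) (hpow _ _ (by omega)) (by rw [hme]; ring)
    refine ⟨f, fun u => L * T.redWt c u, fun u hu => ⟨hf u hu, ?_, Or.inr ⟨(hgr u hu).1, ?_, le_rfl⟩⟩,
      fun j hj => ?_⟩
    · exact Nat.mul_pos (by omega) (hgr u hu).2
    · exact Nat.le_mul_of_pos_left _ (by omega)
    · rw [← Finset.mul_sum, hsum j hj, hme]
  · obtain ⟨f, s, hfs, hsum⟩ := exists_packing_between hc hN0 hpack (by omega) le_rfl hmr hv hterm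
      hb₁ hb₂ hbR (hmany v _ hv (reach_self hc hN0 hv hterm) hterm) (hpow _ _ (by omega))
      (hpow _ _ (by omega))
    exact ⟨f, s, fun u hu => ⟨(hfs u hu).1, (hgr u hu).2.trans (hfs u hu).2.1,
      Or.inr ⟨(hgr u hu).1, (hfs u hu).2⟩⟩, hsum⟩

end TypedTree

/-! ### Coding a metric space by infinite words -/

/-- `X` is parametrized by the infinite words in `N` letters, with distances comparable to `ρ ^ k`,
where `k` is the first position at which two words differ. -/
def HasCoding (X : Type*) [MetricSpace X] (N : ℕ) : Prop :=
  ∃ e : X → ℕ → Fin N, Function.Bijective e ∧ ∃ ρ C : ℝ, 0 < ρ ∧ ρ < 1 ∧ 0 < C ∧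
    ∀ x y, x ≠ y → C⁻¹ * ρ ^ PiNat.firstDiff (e x) (e y) ≤ dist x y ∧
      dist x y ≤ C * ρ ^ PiNat.firstDiff (e x) (e y)

theorem le_firstDiff {E : ℕ → Type*} {x y : ∀ n, E n} (h : x ≠ y) {k : ℕ}
    (hk : ∀ j < k, x j = y j) : k ≤ PiNat.firstDiff x y := by
  by_contra! hlt
  exact PiNat.apply_firstDiff_ne h (hk _ hlt)

theorem firstDiff_le {E : ℕ → Type*} {x y : ∀ n, E n} {k : ℕ} (hk : x k ≠ y k) :
    PiNat.firstDiff x y ≤ k := by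
  by_contra! hlt
  exact hk (PiNat.apply_eq_of_lt_firstDiff hlt)

theorem exists_partition_of_sum_eq {V : Type*} (I : Finset V) (s : V → ℕ) (q : ℕ)
    (h : ∑ u ∈ I, s u = q) : ∃ P : V → Finset (Fin q),
      (∀ u ∈ I, (P u).card = s u) ∧ ∀ z, ∃! u, u ∈ I ∧ z ∈ P u := by
  classical
  have hcard : Fintype.card (Σ u : I, Fin (s u)) = Fintype.card (Fin q) := by
    simp only [Fintype.card_sigma, Fintype.card_fin, ← h]
    exact Finset.sum_coe_sort I s
  let φ := Fintype.equivOfCardEq hcard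
  refine ⟨fun u => {z | ((φ.symm z).1 : V) = u}, fun u hu => ?_, fun z => ?_⟩
  · rw [← Fintype.card_fin (s u), ← Finset.card_univ]
    symm
    refine Finset.card_bij (fun i _ => φ ⟨⟨u, hu⟩, i⟩) (by simp) (by simp) fun z hz => ?_
    have hz' : ((φ.symm z).1 : V) = u := by simpa using hz
    obtain ⟨⟨⟨w, hw⟩, i⟩, hi⟩ : ∃ p, p = φ.symm z := ⟨_, rfl⟩
    rw [← hi] at hz'
    subst hz'
    exact ⟨i, Finset.mem_univ _, by rw [hi, Equiv.apply_symm_apply]⟩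
  · refine ⟨(φ.symm z).1, ⟨(φ.symm z).1.2, by simp⟩, ?_⟩
    rintro u ⟨-, hu⟩
    simpa using (by simpa using hu : ((φ.symm z).1 : V) = u).symm

/-- One step of a matching, in terms of letters: the children of a vertex matched with a set `Q` of
letters are distributed among the letters `j ∈ Q`, and the children attached to `j` divide all
letters that can follow `j` among themselves. -/
theorem exists_letters {V : Type*} (I : Finset V) (A : V → ℕ → Prop) (q : ℕ) (Q : Finset (Fin q))
    (h : ∃ f s : V → ℕ, (∀ u ∈ I, f u < Q.card ∧ 1 ≤ s u ∧ A u (s u)) ∧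
      ∀ j < Q.card, ∑ u ∈ I with f u = j, s u = q) :
    ∃ (bin : V → Option (Fin q)) (dig : V → Finset (Fin q)),
      (∀ u ∈ I, (∃ j ∈ Q, bin u = some j) ∧ (dig u).Nonempty ∧ A u (dig u).card) ∧
      ∀ j ∈ Q, ∀ z, ∃! u, u ∈ I ∧ bin u = some j ∧ z ∈ dig u := by
  classical
  obtain ⟨f, s, hfs, hsum⟩ := h
  let φ := Q.equivFin
  choose! P hPcard hP using fun j (hj : j < Q.card) =>
    exists_partition_of_sum_eq {u ∈ I | f u = j} s q (hsum j hj)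
  refine ⟨fun u => if hu : f u < Q.card then some (φ.symm ⟨f u, hu⟩ : Fin q) else none,
    fun u => P (f u) u, fun u hu => ?_, fun j hj z => ?_⟩
  · obtain ⟨h1, h2, h3⟩ := hfs u hu
    have h4 := hPcard (f u) h1 u (by simp [hu])
    refine ⟨⟨φ.symm ⟨f u, h1⟩, Finset.coe_mem _, by simp [h1]⟩, ?_, by rwa [h4]⟩
    rw [← Finset.card_pos, h4]
    exact h2
  · have hiff : ∀ u ∈ I, (if hu : f u < Q.card then some (φ.symm ⟨f u, hu⟩ : Fin q) else none) =
        some j ↔ f u = φ ⟨j, hj⟩ := by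
      intro u hu
      have h1 := (hfs u hu).1
      rw [dif_pos h1, Option.some_inj]
      constructor
      · intro h2
        have h3 : φ.symm ⟨f u, h1⟩ = ⟨j, hj⟩ := Subtype.ext h2
        rw [← h3, Equiv.apply_symm_apply]
      · intro h2
        have h3 : (⟨f u, h1⟩ : Fin Q.card) = φ ⟨j, hj⟩ := Fin.ext h2
        rw [h3, Equiv.symm_apply_apply]
    obtain ⟨u, ⟨hu, huz⟩, huniq⟩ := hP (φ ⟨j, hj⟩) (φ ⟨j, hj⟩).2 z
    rw [Finset.mem_filter] at hu
    refine ⟨u, ⟨hu.1, (hiff u hu.1).2 hu.2, by simpa only [hu.2] using huz⟩, ?_⟩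
    rintro w ⟨hw, hwb, hwz⟩
    have h1 := (hiff w hw).1 hwb
    refine huniq w ⟨Finset.mem_filter.2 ⟨hw, h1⟩, ?_⟩
    simpa only [h1] using hwz

/-- A compact space with a tree of closed sets is coded by infinite words, if the vertices of the tree
can be matched with sets of words as in `exists_letters`. A point of the space follows a path in the
tree, and the letters of its code are the letters to which the vertices of this path are attached.
Two paths that separate at level `k + 1` have codes that separate at position `k` or `k + 1`. -/
theorem exists_coding_of_tree {X : Type*} [MetricSpace X] [CompactSpace X] {V : Type*}
    (ch : V → Finset V) (lev : ℕ → V → Prop) (root : V) (F : ℕ → V → Set X) {r c C : ℝ}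
    (hr0 : 0 < r) (hr1 : r < 1) (hc : 0 < c) (hC : 0 < C)
    (hroot : lev 0 root) (hlev : ∀ k v u, lev k v → u ∈ ch v → lev (k + 1) u)
    (hFroot : F 0 root = Set.univ) (hclosed : ∀ k v, lev k v → IsClosed (F k v))
    (hne : ∀ k v, lev k v → (F k v).Nonempty)
    (hcover : ∀ k v, lev k v → F k v = ⋃ u ∈ ch v, F (k + 1) u)
    (hdiam : ∀ k v, lev k v → ∀ x ∈ F k v, ∀ y ∈ F k v, dist x y ≤ C * r ^ k)
    (hsep : ∀ k v, lev k v → ∀ u ∈ ch v, ∀ w ∈ ch v, u ≠ w →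
      ∀ x ∈ F (k + 1) u, ∀ y ∈ F (k + 1) w, c * r ^ k ≤ dist x y)
    (q b : ℕ) (hbq : b ≤ q) (A : V → ℕ → Prop) (hA : A root b)
    (hstep : ∀ k v b, lev k v → A v b → ∃ f s : V → ℕ,
      (∀ u ∈ ch v, f u < b ∧ 1 ≤ s u ∧ A u (s u)) ∧ ∀ j < b, ∑ u ∈ ch v with f u = j, s u = q) :
    ∃ (Q₀ : Finset (Fin q)) (e : X → ℕ → Fin q), Q₀.card = b ∧ Function.Injective e ∧
      Set.range e = {y | y 0 ∈ Q₀} ∧ ∀ x y, x ≠ y →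
        c * r ^ PiNat.firstDiff (e x) (e y) ≤ dist x y ∧
        dist x y ≤ C * r⁻¹ * r ^ PiNat.firstDiff (e x) (e y) := by
  classical
  have : Nonempty V := ⟨root⟩
  obtain ⟨Q₀, -, hQ₀⟩ := Finset.exists_subset_card_eq
    (show b ≤ (Finset.univ : Finset (Fin q)).card by simpa using hbq)
  let Ok : ℕ → V × Finset (Fin q) → Prop := fun k σ => lev k σ.1 ∧ A σ.1 σ.2.card
  choose! bin dig hbd hnext using fun (σ : V × Finset (Fin q)) (h : ∃ k, Ok k σ) =>
    exists_letters (ch σ.1) A q σ.2 (by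
      obtain ⟨k, hk⟩ := h
      exact hstep k σ.1 _ hk.1 hk.2)
  let IsPath : (ℕ → V × Finset (Fin q)) → Prop := fun p => p 0 = (root, Q₀) ∧
    ∀ k, (p (k + 1)).1 ∈ ch (p k).1 ∧ (p (k + 1)).2 = dig (p k) (p (k + 1)).1
  have hok0 : Ok 0 (root, Q₀) := ⟨hroot, by simpa [hQ₀] using hA⟩
  have hokstep : ∀ k σ, Ok k σ → ∀ u ∈ ch σ.1, Ok (k + 1) (u, dig σ u) := fun k σ h u hu =>
    ⟨hlev k _ _ h.1 hu, (hbd σ ⟨k, h⟩ u hu).2.2⟩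
  have hok : ∀ p, IsPath p → ∀ k, Ok k (p k) := by
    intro p hp k
    induction k with
    | zero => rw [hp.1]; exact hok0
    | succ k ih =>
      have h := hokstep k _ ih _ (hp.2 k).1
      rwa [← (hp.2 k).2] at h
  -- Every point lies on a path.
  have hchild : ∀ k σ (x : X), Ok k σ → x ∈ F k σ.1 → ∃ u ∈ ch σ.1, x ∈ F (k + 1) u := by
    intro k σ x h hx
    rw [hcover k _ h.1] at hx
    simpa using hx
  have hpath : ∀ x : X, ∃ p, IsPath p ∧ ∀ k, x ∈ F k (p k).1 := by
    intro x
    choose! child hchild1 hchild2 using fun k σ => hchild k σ x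
    let p : ℕ → V × Finset (Fin q) := fun k =>
      Nat.rec (root, Q₀) (fun k σ => (child k σ, dig σ (child k σ))) k
    have hp : ∀ k, Ok k (p k) ∧ x ∈ F k (p k).1 := by
      intro k
      induction k with
      | zero => exact ⟨hok0, by change x ∈ F 0 root; rw [hFroot]; trivial⟩
      | succ k ih =>
        exact ⟨hokstep k _ ih.1 _ (hchild1 k _ ih.1 ih.2), hchild2 k _ ih.1 ih.2⟩
    exact ⟨p, ⟨rfl, fun k => ⟨hchild1 k _ (hp k).1 (hp k).2, rfl⟩⟩, fun k => (hp k).2⟩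
  -- Every path has a point.
  have hpoint : ∀ p, IsPath p → ∃ x, ∀ k, x ∈ F k (p k).1 := by
    intro p hp
    have h := IsCompact.nonempty_iInter_of_sequence_nonempty_isCompact_isClosed
      (fun k => F k (p k).1) (fun k => by
        have h1 := hcover k _ (hok p hp k).1
        intro x hx
        rw [h1]
        exact Set.mem_biUnion (hp.2 k).1 hx) (fun k => hne k _ (hok p hp k).1)
      (hclosed 0 _ (hok p hp 0).1).isCompact fun k => hclosed k _ (hok p hp k).1
    obtain ⟨x, hx⟩ := h
    exact ⟨x, fun k => Set.mem_iInter.1 hx k⟩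
  -- Distinct paths separate at some level.
  have hsplit : ∀ p p', IsPath p → IsPath p' → p ≠ p' →
      ∃ k, (∀ j ≤ k, p j = p' j) ∧ (p (k + 1)).1 ≠ (p' (k + 1)).1 := by
    intro p p' hp hp' hne
    have hfd := PiNat.apply_firstDiff_ne (E := fun _ => V × Finset (Fin q)) hne
    obtain ⟨k, hk⟩ : ∃ k, PiNat.firstDiff (E := fun _ => V × Finset (Fin q)) p p' = k + 1 := by
      refine Nat.exists_eq_succ_of_ne_zero fun h => hfd ?_
      rw [h, hp.1, hp'.1]
    have heq : ∀ j ≤ k, p j = p' j := fun j hj =>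
      PiNat.apply_eq_of_lt_firstDiff (E := fun _ => V × Finset (Fin q)) (by omega)
    refine ⟨k, heq, fun h => hfd ?_⟩
    rw [hk]
    refine Prod.ext h ?_
    rw [(hp.2 k).2, (hp'.2 k).2, h, heq k le_rfl]
  choose P hP hPx using hpath
  have hbin : ∀ p, IsPath p → ∀ k, ∃ j ∈ (p k).2, bin (p k) (p (k + 1)).1 = some j := fun p hp k =>
    (hbd (p k) ⟨k, hok p hp k⟩ _ (hp.2 k).1).1
  have : Nonempty (Fin q) := by
    obtain ⟨x, -⟩ := hne 0 root hroot
    exact ⟨(hbin _ (hP x) 0).choose⟩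
  choose! code hcodeQ hcode using hbin
  -- Separation of codes.
  have hcodesplit : ∀ p p', IsPath p → IsPath p' → ∀ k, (∀ j ≤ k, p j = p' j) →
      (p (k + 1)).1 ≠ (p' (k + 1)).1 →
      (∀ j < k, code p j = code p' j) ∧
        (code p k ≠ code p' k ∨ code p (k + 1) ≠ code p' (k + 1)) := by
    intro p p' hp hp' k hk hne
    constructor
    · intro j hj
      have h1 := hcode p hp j
      rw [hk j hj.le, hk (j + 1) hj, hcode p' hp' j, Option.some_inj] at h1
      exact h1.symm
    · by_contra! h
      refine hne ((hnext (p k) ⟨k, hok p hp k⟩ (code p k) (hcodeQ p hp k) (code p (k + 1))).unique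
        ⟨(hp.2 k).1, hcode p hp k, ?_⟩ ⟨?_, ?_, ?_⟩)
      · rw [← (hp.2 k).2]
        exact hcodeQ p hp (k + 1)
      · rw [hk k le_rfl]
        exact (hp'.2 k).1
      · rw [h.1, hk k le_rfl]
        exact hcode p' hp' k
      · rw [h.2, hk k le_rfl, ← (hp'.2 k).2]
        exact hcodeQ p' hp' (k + 1)
  have hPne : ∀ x y, x ≠ y → P x ≠ P y := by
    intro x y hxy h
    have h1 : ∀ k, dist x y ≤ C * r ^ k := fun k =>
      hdiam k _ (hok _ (hP x) k).1 x (hPx x k) y (by rw [h]; exact hPx y k)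
    have h2 : Filter.Tendsto (fun k => C * r ^ k) Filter.atTop (nhds (C * 0)) :=
      (tendsto_pow_atTop_nhds_zero_of_lt_one hr0.le hr1).const_mul C
    have h3 := ge_of_tendsto' h2 h1
    rw [mul_zero] at h3
    exact hxy (dist_le_zero.1 h3)
  have hPeq : ∀ p, IsPath p → ∀ x, (∀ k, x ∈ F k (p k).1) → P x = p := by
    intro p hp x hx
    by_contra hne
    obtain ⟨k, hk, hk1⟩ := hsplit _ _ (hP x) hp hne
    have h := hsep k _ (hok _ (hP x) k).1 _ ((hP x).2 k).1 _
      (by rw [hk k le_rfl]; exact (hp.2 k).1) hk1 x (hPx x _) x (hx _)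
    rw [dist_self] at h
    exact absurd h (not_le.2 (by positivity))
  have hmain : ∀ x y, x ≠ y → ∃ k, (c * r ^ k ≤ dist x y ∧ dist x y ≤ C * r ^ k) ∧
      (∀ j < k, code (P x) j = code (P y) j) ∧
        (code (P x) k ≠ code (P y) k ∨ code (P x) (k + 1) ≠ code (P y) (k + 1)) := by
    intro x y hxy
    obtain ⟨k, hk, hk1⟩ := hsplit _ _ (hP x) (hP y) (hPne x y hxy)
    refine ⟨k, ⟨?_, ?_⟩, hcodesplit _ _ (hP x) (hP y) k hk hk1⟩
    · exact hsep k _ (hok _ (hP x) k).1 _ ((hP x).2 k).1 _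
        (by rw [hk k le_rfl]; exact ((hP y).2 k).1) hk1 x (hPx x _) y (hPx y _)
    · exact hdiam k _ (hok _ (hP x) k).1 x (hPx x k) y (by rw [hk k le_rfl]; exact hPx y k)
  have hinj : Function.Injective fun x => code (P x) := by
    intro x y h
    by_contra hxy
    obtain ⟨k, -, -, h1⟩ := hmain x y hxy
    simp only at h
    rw [h] at h1
    exact h1.elim (fun h => h rfl) fun h => h rfl
  refine ⟨Q₀, fun x => code (P x), hQ₀, hinj, ?_, ?_⟩
  · ext y
    constructor
    · rintro ⟨x, rfl⟩
      have h := hcodeQ _ (hP x) 0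
      rwa [(hP x).1] at h
    · intro hy
      choose! next hn using fun (σ : V × Finset (Fin q)) (h : ∃ k, Ok k σ) j hj z =>
        (hnext σ h j hj z).exists
      let p : ℕ → V × Finset (Fin q) := fun k => Nat.rec (root, Q₀)
        (fun k σ => (next σ (y k) (y (k + 1)), dig σ (next σ (y k) (y (k + 1))))) k
      have hp : ∀ k, Ok k (p k) ∧ y k ∈ (p k).2 := by
        intro k
        induction k with
        | zero => exact ⟨hok0, hy⟩
        | succ k ih =>
          have h := hn (p k) ⟨k, ih.1⟩ (y k) ih.2 (y (k + 1))
          exact ⟨hokstep k _ ih.1 _ h.1, h.2.2⟩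
      have hpp : IsPath p := ⟨rfl, fun k =>
        ⟨(hn (p k) ⟨k, (hp k).1⟩ (y k) (hp k).2 (y (k + 1))).1, rfl⟩⟩
      obtain ⟨x, hx⟩ := hpoint p hpp
      refine ⟨x, funext fun k => ?_⟩
      have h1 := hcode p hpp k
      have h2 := (hn (p k) ⟨k, (hp k).1⟩ (y k) (hp k).2 (y (k + 1))).2.1
      simp only
      rw [hPeq p hpp x hx]
      exact Option.some_inj.1 (h1.symm.trans h2)
  · intro x y hxy
    obtain ⟨k, ⟨h1, h2⟩, h3, h4⟩ := hmain x y hxy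
    have hle : k ≤ PiNat.firstDiff (code (P x)) (code (P y)) :=
      le_firstDiff (fun h => hxy (hinj h)) h3
    have hge : PiNat.firstDiff (code (P x)) (code (P y)) ≤ k + 1 :=
      h4.elim (fun h => (firstDiff_le h).trans (Nat.le_succ k)) fun h => firstDiff_le h
    constructor
    · refine le_trans ?_ h1
      exact mul_le_mul_of_nonneg_left (pow_le_pow_of_le_one hr0.le hr1.le hle) hc.le
    · refine h2.trans ?_
      rw [mul_assoc]
      refine mul_le_mul_of_nonneg_left ?_ hC.le
      rw [inv_mul_eq_div, le_div_iff₀ hr0, ← pow_succ]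
      exact pow_le_pow_of_le_one hr0.le hr1.le hge

/-- Regrouping of letters: the first letter is recoded by `ι`, and each of the following blocks of
`m` letters by `enc`. -/
def regroup {α β : Type*} (ι : α → β) (m : ℕ) (enc : (Fin m → α) → β) (z : ℕ → α) : ℕ → β
  | 0 => ι (z 0)
  | k + 1 => enc fun i => z (1 + m * k + i)

theorem regroup_congr {α β : Type*} {ι : α → β} {m : ℕ} {enc : (Fin m → α) → β} {z w : ℕ → α}
    {k : ℕ} (h : ∀ j < 1 + m * k, z j = w j) {i : ℕ} (hi : i ≤ k) :
    regroup ι m enc z i = regroup ι m enc w i := by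
  cases i with
  | zero => simp only [regroup]; rw [h 0 (by omega)]
  | succ i =>
    simp only [regroup]
    congr 1
    ext l
    refine h _ ?_
    have h1 : m * (i + 1) ≤ m * k := Nat.mul_le_mul_left m hi
    have h2 : m * (i + 1) = m * i + m := by ring
    have := l.2
    omega

theorem eq_of_regroup_eq {α β : Type*} {ι : α → β} {m : ℕ} {enc : (Fin m → α) → β}
    (hι : Function.Injective ι) (hm : 1 ≤ m) (henc : Function.Injective enc) {z w : ℕ → α} {k : ℕ}
    (h : ∀ i ≤ k, regroup ι m enc z i = regroup ι m enc w i) {j : ℕ} (hj : j < 1 + m * k) :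
    z j = w j := by
  rcases Nat.eq_zero_or_pos j with rfl | hpos
  · exact hι (h 0 (Nat.zero_le _))
  · have hlt : (j - 1) / m < k := by
      rw [Nat.div_lt_iff_lt_mul (by omega), mul_comm]
      omega
    have h1 := congrFun (henc (h ((j - 1) / m + 1) hlt)) ⟨(j - 1) % m, Nat.mod_lt _ (by omega)⟩
    have h2 := Nat.div_add_mod (j - 1) m
    simp only at h1
    rwa [show 1 + m * ((j - 1) / m) + (j - 1) % m = j by omega] at h1

theorem regroup_injective {α β : Type*} {ι : α → β} {m : ℕ} {enc : (Fin m → α) → β}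
    (hι : Function.Injective ι) (hm : 1 ≤ m) (henc : Function.Injective enc) :
    Function.Injective (regroup ι m enc) := fun z w h => funext fun j =>
  eq_of_regroup_eq hι hm henc (k := j) (fun i _ => congrFun h i)
    (by have := Nat.mul_le_mul_right j hm; omega)

theorem firstDiff_regroup {α β : Type*} {ι : α → β} {m : ℕ} {enc : (Fin m → α) → β}
    (hι : Function.Injective ι) (hm : 1 ≤ m) (henc : Function.Injective enc) {z w : ℕ → α}
    (hzw : z ≠ w) :
    PiNat.firstDiff z w ≤
        m * PiNat.firstDiff (E := fun _ => β) (regroup ι m enc z) (regroup ι m enc w) ∧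
      m * PiNat.firstDiff (E := fun _ => β) (regroup ι m enc z) (regroup ι m enc w) ≤
        PiNat.firstDiff z w + m := by
  have hne : regroup ι m enc z ≠ regroup ι m enc w :=
    fun h => hzw (regroup_injective hι hm henc h)
  set k := PiNat.firstDiff (E := fun _ => β) (regroup ι m enc z) (regroup ι m enc w) with hk
  constructor
  · by_contra! hlt
    refine PiNat.apply_firstDiff_ne (E := fun _ => β) hne ?_
    rw [← hk]
    exact regroup_congr (k := k)
      (fun j hj => PiNat.apply_eq_of_lt_firstDiff (E := fun _ => α) (by omega)) le_rfl
  · rcases Nat.eq_zero_or_pos k with h0 | hpos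
    · rw [h0]
      omega
    · have h1 : 1 + m * (k - 1) ≤ PiNat.firstDiff z w := by
        refine le_firstDiff hzw fun j hj => eq_of_regroup_eq hι hm henc (k := k - 1) (fun i hi => ?_) hj
        exact PiNat.apply_eq_of_lt_firstDiff (E := fun _ => β) (by omega)
      obtain ⟨k', hk'⟩ : ∃ k', k = k' + 1 := ⟨k - 1, by omega⟩
      rw [hk', Nat.add_sub_cancel] at h1
      rw [hk', mul_add, mul_one]
      omega

theorem hasCoding_of_restricted {X : Type*} [MetricSpace X] {N m : ℕ} (hm : 1 ≤ m)
    {ρ c C : ℝ} (hρ0 : 0 < ρ) (hρ1 : ρ < 1) (hc : 0 < c) (hC : 0 < C) (Q₀ : Finset (Fin (N ^ m)))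
    (hQ₀ : Q₀.card = N) (e : X → ℕ → Fin (N ^ m)) (he : Function.Injective e)
    (hrange : Set.range e = {y | y 0 ∈ Q₀})
    (hdist : ∀ x y, x ≠ y → c * (ρ ^ m) ^ PiNat.firstDiff (e x) (e y) ≤ dist x y ∧
      dist x y ≤ C * (ρ ^ m) ^ PiNat.firstDiff (e x) (e y)) : HasCoding X N := by
  let φ : Q₀ ≃ Fin N := Q₀.equivFinOfCardEq hQ₀
  let ι : Fin N → Fin (N ^ m) := fun a => (φ.symm a : Fin (N ^ m))
  have hι : Function.Injective ι := fun a b h => φ.symm.injective (Subtype.ext h)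
  let enc : (Fin m → Fin N) ≃ Fin (N ^ m) := finFunctionFinEquiv
  have hsurj : ∀ y : ℕ → Fin (N ^ m), y 0 ∈ Q₀ → ∃ z, regroup ι m enc z = y := by
    intro y hy
    refine ⟨fun j => if j = 0 then φ ⟨y 0, hy⟩ else
      enc.symm (y ((j - 1) / m + 1)) ⟨(j - 1) % m, Nat.mod_lt _ hm⟩, funext fun k => ?_⟩
    cases k with
    | zero => simp [regroup, ι]
    | succ k =>
      simp only [regroup]
      rw [← Equiv.eq_symm_apply]
      ext1 i
      have h1 : (1 + m * k + i - 1) / m = k := by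
        rw [show 1 + m * k + (i : ℕ) - 1 = i + m * k by omega, Nat.add_mul_div_left _ _ (by omega),
          Nat.div_eq_of_lt i.2, zero_add]
      have h2 : (1 + m * k + i - 1) % m = i := by
        rw [show 1 + m * k + (i : ℕ) - 1 = i + m * k by omega, Nat.add_mul_mod_self_left,
          Nat.mod_eq_of_lt i.2]
      rw [if_neg (by omega)]
      simp only [h1, h2]
  have hex : ∀ x, ∃ z, regroup ι m enc z = e x := fun x =>
    hsurj _ (by
      have : e x ∈ Set.range e := ⟨x, rfl⟩
      rwa [hrange] at this)
  choose g hg using hex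
  have hginj : Function.Injective g := fun x y h => he (by rw [← hg x, ← hg y, h])
  refine ⟨g, ⟨hginj, fun z => ?_⟩, ρ, max C (c * ρ ^ m)⁻¹, hρ0, hρ1, lt_max_of_lt_left hC,
    fun x y hxy => ?_⟩
  · have : regroup ι m enc z ∈ Set.range e := by
      rw [hrange]
      exact (φ.symm (z 0)).2
    obtain ⟨x, hx⟩ := this
    exact ⟨x, regroup_injective hι hm enc.injective ((hg x).trans hx)⟩
  · obtain ⟨h1, h2⟩ := firstDiff_regroup hι hm enc.injective fun h => hxy (hginj h)
    obtain ⟨h3, h4⟩ := hdist x y hxy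
    rw [hg x, hg y] at h1 h2
    rw [← pow_mul] at h3 h4
    constructor
    · refine le_trans ?_ h3
      calc (max C (c * ρ ^ m)⁻¹)⁻¹ * ρ ^ PiNat.firstDiff (g x) (g y)
          ≤ ((c * ρ ^ m)⁻¹)⁻¹ * ρ ^ PiNat.firstDiff (g x) (g y) := by
            gcongr
            exact le_max_right _ _
        _ = c * ρ ^ (PiNat.firstDiff (g x) (g y) + m) := by rw [inv_inv, pow_add]; ring
        _ ≤ _ := mul_le_mul_of_nonneg_left (pow_le_pow_of_le_one hρ0.le hρ1.le h2) hc.le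
    · refine h4.trans ?_
      calc C * ρ ^ (m * PiNat.firstDiff (e x) (e y))
          ≤ C * ρ ^ PiNat.firstDiff (g x) (g y) :=
            mul_le_mul_of_nonneg_left (pow_le_pow_of_le_one hρ0.le hρ1.le h1) hC.le
        _ ≤ _ := by
            gcongr
            exact le_max_left _ _

/-! ### Hölder equivalence of coded spaces -/

theorem HasCoding.pow {X : Type*} [MetricSpace X] {N : ℕ} (h : HasCoding X N) {m : ℕ}
    (hm : 1 ≤ m) : HasCoding X (N ^ m) := by
  obtain ⟨e, ⟨hinj, hsurj⟩, ρ, C, hρ0, hρ1, hC, hdist⟩ := h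
  let enc : (Fin m → Fin N) ≃ Fin (N ^ m) := finFunctionFinEquiv
  let g : X → ℕ → Fin (N ^ m) := fun x k => enc fun i => e x (m * k + i)
  have hdm : ∀ j, m * (j / m) + j % m = j := fun j => Nat.div_add_mod j m
  have hg : ∀ x y j, g x (j / m) = g y (j / m) → e x j = e y j := by
    intro x y j h
    have h1 := congrFun (enc.injective h) ⟨j % m, Nat.mod_lt _ hm⟩
    simp only [hdm] at h1
    exact h1
  have hginj : Function.Injective g := fun x y h => hinj (funext fun j => hg x y j (by rw [h]))
  have hfd : ∀ x y, x ≠ y → PiNat.firstDiff (g x) (g y) = PiNat.firstDiff (e x) (e y) / m := by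
    intro x y hxy
    refine le_antisymm (firstDiff_le fun h => ?_) (le_firstDiff (fun h => hxy (hginj h)) fun j hj => ?_)
    · exact PiNat.apply_firstDiff_ne (fun h => hxy (hinj h)) (hg x y _ h)
    · simp only [g]
      congr 1
      ext1 i
      refine PiNat.apply_eq_of_lt_firstDiff ?_
      have h1 := (Nat.le_div_iff_mul_le (by omega)).1 (Nat.succ_le_of_lt hj)
      rw [Nat.succ_mul, mul_comm] at h1
      have := i.2
      omega
  refine ⟨g, ⟨hginj, fun y => ?_⟩, ρ ^ m, max C (C⁻¹ * ρ ^ m)⁻¹ * (ρ ^ m)⁻¹, pow_pos hρ0 m,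
    pow_lt_one₀ hρ0.le hρ1 (by omega),
    mul_pos (lt_max_of_lt_left hC) (inv_pos.2 (pow_pos hρ0 m)), fun x y hxy => ?_⟩
  · obtain ⟨x, hx⟩ := hsurj fun j => enc.symm (y (j / m)) ⟨j % m, Nat.mod_lt _ hm⟩
    refine ⟨x, funext fun k => ?_⟩
    simp only [g]
    rw [← Equiv.eq_symm_apply]
    ext1 i
    rw [hx]
    simp only
    have h1 : (m * k + i) / m = k := by
      rw [add_comm, Nat.add_mul_div_left _ _ (by omega), Nat.div_eq_of_lt i.2, zero_add]
    have h2 : (m * k + i) % m = i := by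
      rw [add_comm, Nat.add_mul_mod_self_left, Nat.mod_eq_of_lt i.2]
    simp only [h1, h2]
  · obtain ⟨h1, h2⟩ := hdist x y hxy
    rw [hfd x y hxy, ← pow_mul]
    set k := PiNat.firstDiff (e x) (e y)
    have hρm := pow_pos hρ0 m
    have hρm1 : ρ ^ m ≤ 1 := pow_le_one₀ hρ0.le hρ1.le
    have h3 : ρ ^ k ≤ ρ ^ (m * (k / m)) := pow_le_pow_of_le_one hρ0.le hρ1.le (Nat.mul_div_le k m)
    have h4 : ρ ^ (m * (k / m)) * ρ ^ m ≤ ρ ^ k := by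
      rw [← pow_add]
      refine pow_le_pow_of_le_one hρ0.le hρ1.le ?_
      have := hdm k
      have := Nat.mod_lt k hm
      omega
    have h5 : C ≤ max C (C⁻¹ * ρ ^ m)⁻¹ * (ρ ^ m)⁻¹ :=
      (le_max_left _ _).trans
        (le_mul_of_one_le_right (lt_max_of_lt_left hC).le ((one_le_inv₀ hρm).2 hρm1))
    constructor
    · refine le_trans ?_ h1
      calc (max C (C⁻¹ * ρ ^ m)⁻¹ * (ρ ^ m)⁻¹)⁻¹ * ρ ^ (m * (k / m))
          ≤ (C * (ρ ^ m)⁻¹)⁻¹ * ρ ^ (m * (k / m)) := by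
            gcongr
            exact le_max_left _ _
        _ = C⁻¹ * (ρ ^ (m * (k / m)) * ρ ^ m) := by rw [mul_inv, inv_inv]; ring
        _ ≤ C⁻¹ * ρ ^ k := mul_le_mul_of_nonneg_left h4 (inv_pos.2 hC).le
    · exact h2.trans (mul_le_mul h5 h3 (pow_pos hρ0 _).le (hC.le.trans h5))

theorem HasCoding.strictlyHolderEquivalent {X Y : Type*} [MetricSpace X] [MetricSpace Y] {N : ℕ}
    (hX : HasCoding X N) (hY : HasCoding Y N) : StrictlyHolderEquivalent X Y := by
  obtain ⟨e, he, ρ, C, hρ0, hρ1, hC, hd⟩ := hX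
  obtain ⟨e', he', ρ', C', hρ0', hρ1', hC', hd'⟩ := hY
  let f : X ≃ Y := (Equiv.ofBijective e he).trans (Equiv.ofBijective e' he').symm
  have hf : ∀ x, e' (f x) = e x := fun x => (Equiv.ofBijective e' he').apply_symm_apply (e x)
  have hlog := Real.log_neg hρ0 hρ1
  have hlog' := Real.log_neg hρ0' hρ1'
  set s := Real.log ρ' / Real.log ρ with hs
  have hs0 : 0 < s := div_pos_of_neg_of_neg hlog' hlog
  have hρs : ρ ^ s = ρ' := by
    rw [Real.rpow_def_of_pos hρ0, hs, mul_div_cancel₀ _ hlog.ne, Real.exp_log hρ0']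
  refine ⟨f, f.bijective, s, C' * C ^ s, hs0, by positivity, fun x y => ?_⟩
  rcases eq_or_ne x y with rfl | hxy
  · simp [Real.zero_rpow hs0.ne']
  obtain ⟨h1, h2⟩ := hd x y hxy
  obtain ⟨h3, h4⟩ := hd' (f x) (f y) fun h => hxy (f.injective h)
  rw [hf, hf] at h3 h4
  set k := PiNat.firstDiff (e x) (e y)
  have hk : ρ' ^ k = (ρ ^ k) ^ s := by
    rw [← hρs, ← Real.rpow_natCast, ← Real.rpow_natCast, ← Real.rpow_mul hρ0.le,
      ← Real.rpow_mul hρ0.le, mul_comm]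
  have hρk := pow_pos hρ0 k
  constructor
  · refine le_trans ?_ h3
    rw [hk, mul_inv, mul_assoc]
    refine mul_le_mul_of_nonneg_left ?_ (inv_pos.2 hC').le
    rw [← Real.inv_rpow hC.le, ← Real.mul_rpow (inv_pos.2 hC).le dist_nonneg]
    refine Real.rpow_le_rpow (by positivity) ?_ hs0.le
    rw [inv_mul_le_iff₀ hC]
    exact h2
  · refine h4.trans ?_
    rw [hk, mul_assoc]
    refine mul_le_mul_of_nonneg_left ?_ hC'.le
    rw [← Real.mul_rpow hC.le dist_nonneg]
    refine Real.rpow_le_rpow hρk.le ?_ hs0.le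
    rwa [inv_mul_le_iff₀ hC] at h1

/-! ### Rigidity of Hölder equivalences between spaces of words -/

theorem exists_quasi_isometry {X Y : Type*} [MetricSpace X] [MetricSpace Y] {N N' : ℕ}
    (hX : HasCoding X N) (hY : HasCoding Y N') (h : StrictlyHolderEquivalent X Y) :
    ∃ (φ : (ℕ → Fin N) → ℕ → Fin N') (θ c : ℝ), Function.Bijective φ ∧ 0 < θ ∧ 0 ≤ c ∧
      ∀ x y, x ≠ y → θ * PiNat.firstDiff x y - c ≤ PiNat.firstDiff (φ x) (φ y) ∧
        PiNat.firstDiff (φ x) (φ y) ≤ θ * PiNat.firstDiff x y + c := by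
  obtain ⟨e, he, ρ, C₁, hρ0, hρ1, hC₁, hd⟩ := hX
  obtain ⟨e', he', ρ', C₂, hρ0', hρ1', hC₂, hd'⟩ := hY
  obtain ⟨f, hf, s, C, hs, hC, hfd⟩ := h
  let E := Equiv.ofBijective e he
  have hlog := Real.log_neg hρ0 hρ1
  have hlog' := Real.log_neg hρ0' hρ1'
  set K := Real.log (C₂ * C) + s * Real.log C₁ with hK
  refine ⟨fun x => e' (f (E.symm x)), s * (Real.log ρ / Real.log ρ'), |K| / (-Real.log ρ'),
    (he'.comp hf).comp E.symm.bijective, mul_pos hs (div_pos_of_neg_of_neg hlog hlog'),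
    div_nonneg (abs_nonneg _) (by linarith), fun x y hxy => ?_⟩
  have hxy' : E.symm x ≠ E.symm y := fun h => hxy (E.symm.injective h)
  obtain ⟨h1, h2⟩ := hd _ _ hxy'
  obtain ⟨h3, h4⟩ := hd' _ _ fun h => hxy' (hf.1 h)
  obtain ⟨h5, h6⟩ := hfd (E.symm x) (E.symm y)
  have hE : ∀ z, e (E.symm z) = z := fun z => E.apply_symm_apply z
  rw [hE, hE] at h1 h2
  set k := PiNat.firstDiff x y
  set k' := PiNat.firstDiff (e' (f (E.symm x))) (e' (f (E.symm y)))
  set δ := dist (E.symm x) (E.symm y)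
  have hδ : 0 < δ := dist_pos.2 hxy'
  have hδs : 0 < δ ^ s := Real.rpow_pos_of_pos hδ s
  have hρk := pow_pos hρ0 k
  have hρk' := pow_pos hρ0' k'
  have h7 : Real.log ρ * k - Real.log C₁ ≤ Real.log δ := by
    have := Real.log_le_log (by positivity) h1
    rw [Real.log_mul (inv_pos.2 hC₁).ne' hρk.ne', Real.log_inv, Real.log_pow] at this
    linarith
  have h8 : Real.log δ ≤ Real.log ρ * k + Real.log C₁ := by
    have := Real.log_le_log hδ h2
    rw [Real.log_mul hC₁.ne' hρk.ne', Real.log_pow] at this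
    linarith
  have h9 : Real.log ρ' * k' ≤ s * Real.log δ + Real.log (C₂ * C) := by
    have := Real.log_le_log (by positivity) (h3.trans h6)
    rw [Real.log_mul (inv_pos.2 hC₂).ne' hρk'.ne', Real.log_inv, Real.log_pow,
      Real.log_mul hC.ne' hδs.ne', Real.log_rpow hδ] at this
    rw [Real.log_mul hC₂.ne' hC.ne']
    linarith
  have h10 : s * Real.log δ - Real.log (C₂ * C) ≤ Real.log ρ' * k' := by
    have := Real.log_le_log (by positivity) (h5.trans h4)
    rw [Real.log_mul (inv_pos.2 hC).ne' hδs.ne', Real.log_inv, Real.log_rpow hδ,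
      Real.log_mul hC₂.ne' hρk'.ne', Real.log_pow] at this
    rw [Real.log_mul hC₂.ne' hC.ne']
    linarith
  have h11 := mul_le_mul_of_nonneg_left h7 hs.le
  have h12 := mul_le_mul_of_nonneg_left h8 hs.le
  have hKabs := abs_le.1 (le_refl |K|)
  have h13 : s * (Real.log ρ / Real.log ρ') * k = (-(s * Real.log ρ * k)) / (-Real.log ρ') := by
    rw [neg_div_neg_eq]
    ring
  have hpos : 0 < -Real.log ρ' := by linarith
  rw [h13]
  constructor
  · rw [← sub_div, div_le_iff₀ hpos]
    nlinarith [hKabs.2]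
  · rw [← add_div, le_div_iff₀ hpos]
    nlinarith [hKabs.2]

section Rigidity

variable {N N' : ℕ} (φ : (ℕ → Fin N) → ℕ → Fin N')

open Classical in
/-- The words of length `n` that are initial words of `φ x'` for some `x'` agreeing with `x` in the
first `k` letters. -/
noncomputable def imageWords (n k : ℕ) (x : ℕ → Fin N) : Finset (Fin n → Fin N') :=
  {u | ∃ x' : ℕ → Fin N, (∀ i < k, x' i = x i) ∧ ∀ i : Fin n, φ x' i = u i}

theorem mem_imageWords {n k : ℕ} {x : ℕ → Fin N} {u : Fin n → Fin N'} :
    u ∈ imageWords φ n k x ↔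
      ∃ x' : ℕ → Fin N, (∀ i < k, x' i = x i) ∧ ∀ i : Fin n, φ x' i = u i := by
  classical
  simp [imageWords]

variable {φ} {L : ℕ → ℕ}

theorem card_imageWords_succ (hφ : Function.Bijective φ)
    (hL : ∀ k x y, (∀ i < L k, φ x i = φ y i) → ∀ i < k, x i = y i) {n k : ℕ} (hn : L k ≤ n)
    (x : ℕ → Fin N) :
    (imageWords φ (n + 1) k x).card = N' * (imageWords φ n k x).card := by
  classical
  have himage : imageWords φ (n + 1) k x = (Finset.univ ×ˢ imageWords φ n k x).image
      fun p : Fin N' × (Fin n → Fin N') => Fin.snoc (α := fun _ => Fin N') p.2 p.1 := by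
    ext u
    simp only [Finset.mem_image, Finset.mem_product, Finset.mem_univ, true_and, Prod.exists,
      mem_imageWords]
    constructor
    · rintro ⟨x', hx', hu⟩
      refine ⟨u (Fin.last n), Fin.init u, ⟨x', hx', fun i => ?_⟩, Fin.snoc_init_self u⟩
      exact hu i.castSucc
    · rintro ⟨a, w, ⟨x', hx', hw⟩, rfl⟩
      obtain ⟨x'', hx''⟩ := hφ.2 (Function.update (φ x') n a)
      refine ⟨x'', fun i hi => ?_, fun i => ?_⟩
      · rw [← hx' i hi]
        refine hL k x'' x' (fun j hj => ?_) i hi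
        rw [hx'', Function.update_of_ne (by omega)]
      · rw [hx'']
        refine Fin.lastCases ?_ (fun i => ?_) i
        · simp
        · rw [Fin.snoc_castSucc, ← hw i, Fin.val_castSucc, Function.update_of_ne (by omega)]
  rw [himage, Finset.card_image_of_injective, Finset.card_product, Finset.card_univ,
    Fintype.card_fin]
  rintro ⟨a, w⟩ ⟨a', w'⟩ h
  simp only at h
  have h1 := congrArg Fin.init h
  have h2 := congrFun h (Fin.last n)
  rw [Fin.init_snoc, Fin.init_snoc] at h1
  rw [Fin.snoc_last, Fin.snoc_last] at h2
  rw [h1, h2]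

theorem card_imageWords_add (hφ : Function.Bijective φ)
    (hL : ∀ k x y, (∀ i < L k, φ x i = φ y i) → ∀ i < k, x i = y i) (k j : ℕ) (x : ℕ → Fin N) :
    (imageWords φ (L k + j) k x).card = N' ^ j * (imageWords φ (L k) k x).card := by
  induction j with
  | zero => simp
  | succ j ih =>
    rw [← add_assoc, card_imageWords_succ hφ hL (by omega), ih, pow_succ]
    ring

theorem card_imageWords_eq_sum
    (hL : ∀ k x y, (∀ i < L k, φ x i = φ y i) → ∀ i < k, x i = y i) (k : ℕ) (x : ℕ → Fin N) :
    (imageWords φ (L (k + 1)) k x).card =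
      ∑ a, (imageWords φ (L (k + 1)) (k + 1) (Function.update x k a)).card := by
  classical
  rw [← Finset.card_biUnion]
  · congr 1
    ext u
    simp only [Finset.mem_biUnion, Finset.mem_univ, true_and, mem_imageWords]
    constructor
    · rintro ⟨x', hx', hu⟩
      refine ⟨x' k, x', fun i hi => ?_, hu⟩
      rcases Nat.lt_succ_iff_lt_or_eq.1 hi with hi | rfl
      · rw [Function.update_of_ne hi.ne, hx' i hi]
      · rw [Function.update_self]
    · rintro ⟨a, x', hx', hu⟩
      refine ⟨x', fun i hi => ?_, hu⟩
      rw [hx' i (by omega), Function.update_of_ne hi.ne]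
  · intro a _ a' _ haa'
    refine Finset.disjoint_left.2 fun u hu hu' => haa' ?_
    rw [mem_imageWords] at hu hu'
    obtain ⟨y, hy, hyu⟩ := hu
    obtain ⟨y', hy', hyu'⟩ := hu'
    have h := hL (k + 1) y y' (fun i hi => by
      have h1 := hyu ⟨i, hi⟩
      have h2 := hyu' ⟨i, hi⟩
      simp only at h1 h2
      rw [h1, h2]) k (by omega)
    rwa [hy k (by omega), hy' k (by omega), Function.update_self, Function.update_self] at h

theorem card_imageWords_le {ℓ : ℕ → ℕ} {W : ℕ} (hW : ∀ k, L k ≤ ℓ k + W) (hN' : 1 ≤ N')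
    (hℓ : ∀ k x y, (∀ i < k, x i = y i) → ∀ i < ℓ k, φ x i = φ y i) (k : ℕ) (x : ℕ → Fin N) :
    (imageWords φ (L k) k x).card ≤ N' ^ W := by
  classical
  have : Fintype.card (Fin W → Fin N') = N' ^ W := by simp
  rw [← this, ← Finset.card_univ]
  have hN'' : 0 < N' := hN'
  refine Finset.card_le_card_of_injOn (fun u i => if h : ℓ k + i < L k then u ⟨ℓ k + i, h⟩ else
    ⟨0, hN''⟩) (fun _ _ => Finset.mem_coe.2 (Finset.mem_univ _)) ?_
  intro u hu w hw huw
  rw [Finset.mem_coe, mem_imageWords] at hu hw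
  obtain ⟨y, hy, hyu⟩ := hu
  obtain ⟨y', hy', hyw⟩ := hw
  ext1 i
  by_cases hi : (i : ℕ) < ℓ k
  · rw [← hyu, ← hyw]
    exact hℓ k y y' (fun i hi => (hy i hi).trans (hy' i hi).symm) i hi
  · have h1 := hW k
    have h2 := i.2
    have h3 := congrFun huw ⟨i - ℓ k, by omega⟩
    have h4 : ℓ k + (i - ℓ k) = (i : ℕ) := by omega
    simp only [h4, h2, dif_pos] at h3
    exact h3

theorem pow_le_pow_of_separated (hN : 1 ≤ N)
    (hL : ∀ k x y, (∀ i < L k, φ x i = φ y i) → ∀ i < k, x i = y i) (k : ℕ) :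
    N ^ k ≤ N' ^ L k := by
  have h1 : Fintype.card (Fin k → Fin N) = N ^ k := by simp
  have h2 : Fintype.card (Fin (L k) → Fin N') = N' ^ L k := by simp
  rw [← h1, ← h2]
  let ext : (Fin k → Fin N) → ℕ → Fin N := fun u i => if h : i < k then u ⟨i, h⟩ else ⟨0, hN⟩
  refine Fintype.card_le_of_injective (fun u i => φ (ext u) i) fun u w huw => funext fun i => ?_
  have h3 := hL k (ext u) (ext w) (fun i hi => congrFun huw ⟨i, hi⟩) i i.2
  simpa [ext] using h3

/-- If the spaces of words in `N` and `N'` letters are related by a bijection that distorts the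
lengths of common initial words only linearly, then `N` and `N'` have a common power.

The image of a cylinder of length `k` consists of `a` cylinders of length `L k`, where `a ≥ 1` is
bounded. So the ratio of its uniform measure to that of the given cylinder is
`a * N ^ k / N' ^ L k`. For a cylinder at which this ratio is nearly maximal, the ratios of
its subcylinders are nearly maximal as well, down to any prescribed depth. Among these ratios there
are two with the same numerator `a`, and since the quotient of the two takes only finitely many
values it has to be equal to `1`. -/
theorem exists_pow_eq_pow (hN : 1 ≤ N) (hN' : 1 ≤ N') (hφ : Function.Bijective φ)
    (hL : ∀ k x y, (∀ i < L k, φ x i = φ y i) → ∀ i < k, x i = y i) {ℓ : ℕ → ℕ} {W : ℕ}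
    (hW : ∀ k, L k ≤ ℓ k + W)
    (hℓ : ∀ k x y, (∀ i < k, x i = y i) → ∀ i < ℓ k, φ x i = φ y i) (hmono : Monotone L)
    {W' : ℕ} (hW' : ∀ k, L (k + 1) ≤ L k + W') : ∃ i j : ℕ, 1 ≤ i ∧ N ^ i = N' ^ j := by
  have hNpos : (0 : ℝ) < N := by exact_mod_cast hN
  have hN1 : (1 : ℝ) ≤ N := by exact_mod_cast hN
  have hNpos' : (0 : ℝ) < N' := by exact_mod_cast hN'
  have hN1' : (1 : ℝ) ≤ N' := by exact_mod_cast hN'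
  let a : ℕ → (ℕ → Fin N) → ℕ := fun k x => (imageWords φ (L k) k x).card
  let G : ℕ → (ℕ → Fin N) → ℝ := fun k x => a k x * N ^ k / N' ^ L k
  set A := N' ^ W with hA
  have ha : ∀ k x, a k x ≤ A := card_imageWords_le hW hN' hℓ
  have ha1 : ∀ k x, 1 ≤ a k x := fun k x =>
    Finset.card_pos.2 ⟨fun i => φ x i, (mem_imageWords φ).2 ⟨x, fun _ _ => rfl, fun _ => rfl⟩⟩
  have hGle : ∀ k x, G k x ≤ A := by
    intro k x
    have h1 : ((N : ℝ) ^ k) ≤ (N' : ℝ) ^ L k := by exact_mod_cast pow_le_pow_of_separated hN hL k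
    have h2 : (a k x : ℝ) ≤ A := by exact_mod_cast ha k x
    have hp := pow_pos hNpos' (L k)
    rw [div_le_iff₀ hp]
    exact mul_le_mul h2 h1 (pow_pos hNpos k).le (by positivity)
  have hGpos : ∀ k x, 0 < G k x := fun k x => by
    have : (0 : ℝ) < a k x := by exact_mod_cast ha1 k x
    positivity
  -- The ratio of a cylinder is the mean of the ratios of its subcylinders.
  have hmean : ∀ k x, N * G k x = ∑ b, G (k + 1) (Function.update x k b) := by
    intro k x
    obtain ⟨j, hj⟩ := Nat.exists_eq_add_of_le (hmono (Nat.le_succ k))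
    have h1 := card_imageWords_add hφ hL k j x
    rw [← hj, card_imageWords_eq_sum hL k x] at h1
    have h2 : ∑ b, (a (k + 1) (Function.update x k b) : ℝ) = N' ^ j * a k x := by
      exact_mod_cast h1
    simp only [G]
    rw [← Finset.sum_div, ← Finset.sum_mul, h2, hj, pow_add, pow_succ]
    field_simp
    ring
  let x₀ : ℕ → Fin N := fun _ => ⟨0, hN⟩
  have : Nonempty (ℕ → Fin N) := ⟨x₀⟩
  let S : ℝ := sSup (Set.range fun p : ℕ × (ℕ → Fin N) => G p.1 p.2)
  have hbdd : BddAbove (Set.range fun p : ℕ × (ℕ → Fin N) => G p.1 p.2) :=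
    ⟨A, by rintro _ ⟨p, rfl⟩; exact hGle _ _⟩
  have hGS : ∀ k x, G k x ≤ S := fun k x => le_csSup hbdd ⟨(k, x), rfl⟩
  have hS : 0 < S := (hGpos 0 x₀).trans_le (hGS 0 x₀)
  -- Distinct powers differ by at least `1`, so quotients different from `1` stay away from `1`.
  let δ : ℝ := ((N' : ℝ) ^ (W' * A))⁻¹
  have hδ : 0 < δ := inv_pos.2 (pow_pos hNpos' _)
  have hδ1 : δ ≤ 1 := inv_le_one_of_one_le₀ (one_le_pow₀ hN1')
  let ε : ℝ := S * δ / (4 * N ^ A)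
  have hε : 0 < ε := by positivity
  obtain ⟨_, ⟨⟨k, x⟩, rfl⟩, hkx⟩ := exists_lt_of_lt_csSup
    (Set.range_nonempty fun p : ℕ × (ℕ → Fin N) => G p.1 p.2) (show S - ε < S by linarith)
  simp only at hkx
  have hdeep : ∀ j, S - N ^ j * ε ≤ G (k + j) x := by
    intro j
    induction j with
    | zero => simpa using hkx.le
    | succ j ih =>
      have h1 := hmean (k + j) x
      rw [← Finset.add_sum_erase _ _ (Finset.mem_univ (x (k + j))), Function.update_eq_self] at h1
      have h2 : ∑ b ∈ Finset.univ.erase (x (k + j)), G (k + j + 1) (Function.update x (k + j) b) ≤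
          (N - 1) * S := by
        refine (Finset.sum_le_card_nsmul _ _ S fun b _ => hGS _ _).trans_eq ?_
        rw [Finset.card_erase_of_mem (Finset.mem_univ _), Finset.card_univ, Fintype.card_fin,
          nsmul_eq_mul, Nat.cast_sub hN, Nat.cast_one]
      have h3 := mul_le_mul_of_nonneg_left ih hNpos.le
      rw [← add_assoc, pow_succ]
      linarith
  have hdeep' : ∀ j ≤ A, S - S * δ / 4 ≤ G (k + j) x := by
    intro j hj
    refine le_trans ?_ (hdeep j)
    have h1 : (N : ℝ) ^ j * ε ≤ N ^ A * ε :=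
      mul_le_mul_of_nonneg_right (pow_le_pow_right₀ hN1 hj) hε.le
    have h2 : (N : ℝ) ^ A * ε = S * δ / 4 := by
      simp only [ε]
      field_simp
    linarith
  obtain ⟨i, hi, j, hj, hij, haij⟩ : ∃ i ∈ Finset.range (A + 1), ∃ j ∈ Finset.range (A + 1),
      i ≠ j ∧ a (k + i) x = a (k + j) x := by
    refine Finset.exists_ne_map_eq_of_card_lt_of_maps_to (t := Finset.Icc 1 A) (by simp) ?_
    intro i _
    exact Finset.mem_coe.2 (Finset.mem_Icc.2 ⟨ha1 _ _, ha _ _⟩)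
  wlog hlt : i < j generalizing i j
  · exact this j hj i hi hij.symm haij.symm (by omega)
  rw [Finset.mem_range] at hi hj
  obtain ⟨t, ht⟩ := Nat.exists_eq_add_of_le (hmono (show k + i ≤ k + j by omega))
  obtain ⟨p, rfl⟩ := Nat.exists_eq_add_of_lt hlt
  refine ⟨p + 1, t, by omega, ?_⟩
  have htle : t ≤ W' * A := by
    have h1 : ∀ r s, L (r + s) ≤ L r + W' * s := by
      intro r s
      induction s with
      | zero => simp
      | succ s ih =>
        rw [← add_assoc, mul_add, mul_one]
        exact (hW' _).trans (by omega)
    have h2 := h1 (k + i) (p + 1)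
    rw [show k + i + (p + 1) = k + (i + p + 1) by ring, ht] at h2
    exact (Nat.le_of_add_le_add_left h2).trans (Nat.mul_le_mul_left _ (by omega))
  by_contra hne
  have hGG : G (k + (i + p + 1)) x * N' ^ t = G (k + i) x * N ^ (p + 1) := by
    simp only [G]
    rw [haij, ht, show k + (i + p + 1) = k + i + (p + 1) by ring, pow_add, pow_add]
    field_simp
    ring
  have hg1 := hdeep' i (by omega)
  have hg2 := hdeep' (i + p + 1) (by omega)
  have hg3 := hGS (k + i) x
  have hg4 := hGS (k + (i + p + 1)) x
  set g := G (k + i) x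
  set g' := G (k + (i + p + 1)) x
  have hNt : (1 : ℝ) ≤ N' ^ t := one_le_pow₀ hN1'
  have hδt : δ * N' ^ t ≤ 1 := by
    have h1 : (N' : ℝ) ^ t ≤ N' ^ (W' * A) := pow_le_pow_right₀ hN1' htle
    calc δ * N' ^ t ≤ δ * N' ^ (W' * A) := mul_le_mul_of_nonneg_left h1 hδ.le
      _ = 1 := inv_mul_cancel₀ (pow_pos hNpos' _).ne'
  have hSδ : S * δ ≤ S := mul_le_of_le_one_right hS.le hδ1
  have hgap : (1 : ℝ) ≤ |(N : ℝ) ^ (p + 1) - N' ^ t| := by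
    have h1 : ((N : ℤ) ^ (p + 1) - (N' : ℤ) ^ t) ≠ 0 := fun h =>
      hne (by exact_mod_cast sub_eq_zero.1 h)
    have h2 := Int.one_le_abs h1
    exact_mod_cast h2
  have hprod : g * |(N : ℝ) ^ (p + 1) - N' ^ t| = |g' - g| * N' ^ t := by
    have hg : 0 < g := hGpos _ _
    rw [← abs_of_pos hg, ← abs_mul, abs_of_pos hg, mul_sub, ← hGG, ← sub_mul, abs_mul,
      abs_of_pos (pow_pos hNpos' t)]
  have hsmall : |g' - g| ≤ S * δ / 4 := abs_le.2 ⟨by linarith, by linarith⟩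
  have h1 : |g' - g| * N' ^ t ≤ S / 4 := by
    calc |g' - g| * N' ^ t ≤ S * δ / 4 * N' ^ t :=
          mul_le_mul_of_nonneg_right hsmall (by positivity)
      _ = S / 4 * (δ * N' ^ t) := by ring
      _ ≤ S / 4 * 1 := mul_le_mul_of_nonneg_left hδt (by positivity)
      _ = S / 4 := mul_one _
  have h2 : g ≤ g * |(N : ℝ) ^ (p + 1) - N' ^ t| :=
    le_mul_of_one_le_right (hGpos _ _).le hgap
  linarith

end Rigidity

theorem HasCoding.exists_pow_eq_pow {X Y : Type*} [MetricSpace X] [MetricSpace Y] {N N' : ℕ}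
    (hN : 1 ≤ N) (hN' : 1 ≤ N') (hX : HasCoding X N) (hY : HasCoding Y N')
    (h : StrictlyHolderEquivalent X Y) : ∃ i j : ℕ, 1 ≤ i ∧ N ^ i = N' ^ j := by
  obtain ⟨φ, θ, c, hφ, hθ, hc, hfd⟩ := exists_quasi_isometry hX hY h
  refine _root_.exists_pow_eq_pow (φ := φ) (L := fun k => ⌈θ * k + c⌉₊)
    (ℓ := fun k => ⌊θ * k - c⌋₊) (W := ⌈2 * c + 2⌉₊) (W' := ⌈θ + 1⌉₊) hN hN' hφ ?_ ?_ ?_ ?_ ?_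
  · intro k x y hxy i hi
    by_contra hne
    have hne' : x ≠ y := fun h => hne (by rw [h])
    have h1 : ⌈θ * k + c⌉₊ ≤ PiNat.firstDiff (φ x) (φ y) :=
      le_firstDiff (fun h => hne' (hφ.1 h)) hxy
    have h2 : PiNat.firstDiff x y < k := (firstDiff_le hne).trans_lt hi
    have h3 : (PiNat.firstDiff x y : ℝ) < k := by exact_mod_cast h2
    have h4 := (Nat.le_ceil (θ * k + c)).trans (Nat.cast_le.2 h1)
    have h5 := mul_lt_mul_of_pos_left h3 hθ
    linarith [(hfd x y hne').2]
  · intro k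
    have h1 : (⌈θ * k + c⌉₊ : ℝ) < θ * k + c + 1 := Nat.ceil_lt_add_one (by positivity)
    have h2 := Nat.lt_floor_add_one (θ * k - c)
    have h3 := Nat.le_ceil (2 * c + 2)
    have h4 : (⌈θ * k + c⌉₊ : ℝ) ≤ ⌊θ * k - c⌋₊ + ⌈2 * c + 2⌉₊ := by linarith
    exact_mod_cast h4
  · intro k x y hxy i hi
    rcases eq_or_ne x y with rfl | hne
    · rfl
    refine PiNat.apply_eq_of_lt_firstDiff (hi.trans_le ?_)
    have h1 : (k : ℝ) ≤ PiNat.firstDiff x y := by exact_mod_cast le_firstDiff hne hxy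
    refine Nat.floor_le_of_le ?_
    have h2 := mul_le_mul_of_nonneg_left h1 hθ.le
    linarith [(hfd x y hne).1]
  · intro k l hkl
    refine Nat.ceil_le_ceil ?_
    have h1 : (k : ℝ) ≤ l := by exact_mod_cast hkl
    have h2 := mul_le_mul_of_nonneg_left h1 hθ.le
    linarith
  · intro k
    have h1 : (⌈θ * (k + 1 : ℕ) + c⌉₊ : ℝ) < θ * (k + 1 : ℕ) + c + 1 :=
      Nat.ceil_lt_add_one (by positivity)
    have h2 := Nat.le_ceil (θ * k + c)
    have h3 := Nat.le_ceil (θ + 1)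
    push_cast at h1
    have h4 : (⌈θ * (k + 1 : ℕ) + c⌉₊ : ℝ) ≤ ⌈θ * k + c⌉₊ + ⌈θ + 1⌉₊ := by
      push_cast
      linarith
    exact_mod_cast h4

/-! ### Separation in finite unions of totally disconnected compact sets -/

/-- Relatively clopen subsets of `B` separate closed sets from the complements of their
neighbourhoods: `B` is zero-dimensional. -/
def ClopenSeparated {X : Type*} [TopologicalSpace X] (B : Set X) : Prop :=
  ∀ Z U : Set X, IsClosed Z → IsOpen U → Z ⊆ U →
    ∃ W ⊆ B, IsClosed W ∧ IsClosed (B \ W) ∧ Z ∩ B ⊆ W ∧ W ⊆ U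

theorem IsTotallyDisconnected.clopenSeparated {X : Type*} [TopologicalSpace X] [T2Space X]
    {B : Set X} (hB : IsTotallyDisconnected B) (hc : IsCompact B) : ClopenSeparated B := by
  intro Z U hZ hU hZU
  have : CompactSpace B := isCompact_iff_compactSpace.1 hc
  have : TotallyDisconnectedSpace B := totallyDisconnectedSpace_subtype_iff.2 hB
  obtain ⟨C, hC, hZC, hCU⟩ := exists_clopen_of_closed_subset_open
    (hZ.preimage (continuous_subtype_val (p := (· ∈ B)))) (hU.preimage continuous_subtype_val)
    (Set.preimage_mono hZU)
  refine ⟨Subtype.val '' C, Subtype.coe_image_subset B C, ?_, ?_, ?_, ?_⟩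
  · exact hc.isClosed.isClosedEmbedding_subtypeVal.isClosedMap _ hC.1
  · have h : B \ Subtype.val '' C = Subtype.val '' Cᶜ := by
      ext x
      simp only [Set.mem_sdiff, Set.mem_image, Subtype.exists, exists_and_right, exists_eq_right,
        Set.mem_compl_iff, not_exists]
      exact ⟨fun h => ⟨h.1, h.2 h.1⟩, fun ⟨h1, h2⟩ => ⟨h1, fun _ => h2⟩⟩
    rw [h]
    exact hc.isClosed.isClosedEmbedding_subtypeVal.isClosedMap _ hC.compl.1
  · rintro x ⟨hxZ, hxB⟩
    exact ⟨⟨x, hxB⟩, hZC hxZ, rfl⟩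
  · rintro _ ⟨x, hx, rfl⟩
    exact hCU hx

theorem ClopenSeparated.union {X : Type*} [TopologicalSpace X] {A B : Set X}
    (hA : ClopenSeparated A) (hB : ClopenSeparated B) : ClopenSeparated (A ∪ B) := by
  intro Z U hZ hU hZU
  obtain ⟨W, hWA, hW, hW', hZW, hWU⟩ := hA Z U hZ hU hZU
  -- The part of `B` to be chosen has to contain `W ∩ B` and to miss `A \ W`.
  obtain ⟨W', hWB, hW1, hW1', hZW', hWU'⟩ := hB (Z ∪ W) (U ∩ (A \ W)ᶜ) (hZ.union hW)
    (hU.inter hW'.isOpen_compl) (by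
      rintro x (hx | hx)
      · exact ⟨hZU hx, fun h => h.2 (hZW ⟨hx, h.1⟩)⟩
      · exact ⟨hWU hx, fun h => h.2 hx⟩)
  refine ⟨W ∪ W', Set.union_subset_union hWA hWB, hW.union hW1, ?_, ?_,
    Set.union_subset hWU fun x hx => (hWU' hx).1⟩
  · have h : (A ∪ B) \ (W ∪ W') = (A \ W) ∪ (B \ W') := by
      ext x
      constructor
      · rintro ⟨hx | hx, h⟩
        · exact Or.inl ⟨hx, fun h' => h (Or.inl h')⟩
        · exact Or.inr ⟨hx, fun h' => h (Or.inr h')⟩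
      · rintro (⟨hx, h⟩ | ⟨hx, h⟩)
        · exact ⟨Or.inl hx, fun h' => h'.elim h fun h' => (hWU' h').2 ⟨hx, h⟩⟩
        · exact ⟨Or.inr hx, fun h' => h'.elim (fun h' => h (hZW' ⟨Or.inr h', hx⟩)) h⟩
    rw [h]
    exact hW'.union hW1'
  · rintro x ⟨hxZ, hx | hx⟩
    · exact Or.inl (hZW ⟨hxZ, hx⟩)
    · exact Or.inr (hZW' ⟨Or.inl hxZ, hx⟩)

theorem ClopenSeparated.biUnion {X ι : Type*} [TopologicalSpace X] (I : Finset ι)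
    (B : ι → Set X) (h : ∀ i ∈ I, ClopenSeparated (B i)) : ClopenSeparated (⋃ i ∈ I, B i) := by
  classical
  induction I using Finset.induction_on with
  | empty => exact fun Z U _ _ _ => ⟨∅, by simp⟩
  | insert a I _ ih =>
    rw [Finset.set_biUnion_insert]
    exact (h a (Finset.mem_insert_self _ _)).union
      (ih fun i hi => h i (Finset.mem_insert_of_mem hi))

/-! ### Components of finite sets of lattice points -/

section Lattice

variable {d : ℕ}

/-- Two lattice points are near if the closed unit cubes attached to them intersect. -/
def Near (p q : Fin d → ℤ) : Prop := ∀ i, |p i - q i| ≤ 1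

theorem Near.symm {p q : Fin d → ℤ} (h : Near p q) : Near q p := fun i => by
  rw [abs_sub_comm]
  exact h i

theorem near_add_right_iff {p q t : Fin d → ℤ} : Near (p + t) (q + t) ↔ Near p q := by
  simp [Near]

/-- `p` and `q` are joined by a chain of successively near points of `A`. -/
def Linked (A : Finset (Fin d → ℤ)) : (Fin d → ℤ) → (Fin d → ℤ) → Prop :=
  Relation.ReflTransGen fun p q => p ∈ A ∧ q ∈ A ∧ Near p q

theorem Linked.symm {A : Finset (Fin d → ℤ)} {p q : Fin d → ℤ} (h : Linked A p q) :
    Linked A q p := by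
  have : Std.Symm fun p q => p ∈ A ∧ q ∈ A ∧ Near p q := ⟨fun _ _ h => ⟨h.2.1, h.1, h.2.2.symm⟩⟩
  exact Relation.ReflTransGen.stdSymm.symm _ _ h

open Classical in
/-- The components of `A` with respect to `Linked`. -/
noncomputable def components (A : Finset (Fin d → ℤ)) : Finset (Finset (Fin d → ℤ)) :=
  A.image fun p => {q ∈ A | Linked A p q}

theorem mem_components {A T : Finset (Fin d → ℤ)} :
    T ∈ components A ↔ ∃ p ∈ A, ∀ q, q ∈ T ↔ q ∈ A ∧ Linked A p q := by
  classical
  simp only [components, Finset.mem_image]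
  refine exists_congr fun p => and_congr_right fun _ => ?_
  rw [Finset.ext_iff]
  simp only [Finset.mem_filter]
  exact forall_congr' fun q => iff_comm

theorem subset_of_mem_components {A T : Finset (Fin d → ℤ)} (h : T ∈ components A) : T ⊆ A := by
  obtain ⟨p, -, hT⟩ := mem_components.1 h
  exact fun q hq => ((hT q).1 hq).1

theorem nonempty_of_mem_components {A T : Finset (Fin d → ℤ)} (h : T ∈ components A) :
    T.Nonempty := by
  obtain ⟨p, hp, hT⟩ := mem_components.1 h
  exact ⟨p, (hT p).2 ⟨hp, Relation.ReflTransGen.refl⟩⟩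

theorem exists_mem_components {A : Finset (Fin d → ℤ)} {p : Fin d → ℤ} (hp : p ∈ A) :
    ∃ T ∈ components A, p ∈ T := by
  classical
  exact ⟨_, Finset.mem_image_of_mem _ hp,
    Finset.mem_filter.2 ⟨hp, Relation.ReflTransGen.refl⟩⟩

theorem linked_of_mem_components {A T : Finset (Fin d → ℤ)} (h : T ∈ components A)
    {p q : Fin d → ℤ} (hp : p ∈ T) (hq : q ∈ T) : Linked A p q := by
  obtain ⟨r, -, hT⟩ := mem_components.1 h
  exact ((hT p).1 hp).2.symm.trans ((hT q).1 hq).2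

theorem eq_of_near_of_mem_components {A T T' : Finset (Fin d → ℤ)} (hT : T ∈ components A)
    (hT' : T' ∈ components A) {p q : Fin d → ℤ} (hp : p ∈ T) (hq : q ∈ T') (h : Near p q) :
    T = T' := by
  obtain ⟨r, -, hr⟩ := mem_components.1 hT
  obtain ⟨r', -, hr'⟩ := mem_components.1 hT'
  have hpq : Linked A p q := Relation.ReflTransGen.single
    ⟨((hr p).1 hp).1, ((hr' q).1 hq).1, h⟩
  have hrr' : Linked A r r' := (((hr p).1 hp).2.trans hpq).trans ((hr' q).1 hq).2.symm
  ext s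
  rw [hr, hr']
  exact and_congr_right fun _ => ⟨fun h => hrr'.symm.trans h, fun h => hrr'.trans h⟩

/-- The translate of a finite set of lattice points. -/
def shift (t : Fin d → ℤ) (S : Finset (Fin d → ℤ)) : Finset (Fin d → ℤ) := S.image (· + t)

theorem mem_shift {t q : Fin d → ℤ} {S : Finset (Fin d → ℤ)} : q ∈ shift t S ↔ q - t ∈ S := by
  rw [shift, Finset.mem_image]
  exact ⟨by rintro ⟨p, hp, rfl⟩; simpa using hp, fun h => ⟨q - t, h, by simp⟩⟩

theorem shift_shift (s t : Fin d → ℤ) (S : Finset (Fin d → ℤ)) :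
    shift s (shift t S) = shift (t + s) S := by
  ext q
  rw [mem_shift, mem_shift, mem_shift, sub_sub, add_comm]

theorem shift_zero (S : Finset (Fin d → ℤ)) : shift 0 S = S := by
  ext q
  rw [mem_shift, sub_zero]

theorem card_shift (t : Fin d → ℤ) (S : Finset (Fin d → ℤ)) : (shift t S).card = S.card :=
  Finset.card_image_of_injective _ (add_left_injective t)

theorem Linked.shift {A : Finset (Fin d → ℤ)} {p q : Fin d → ℤ} (h : Linked A p q)
    (t : Fin d → ℤ) : Linked (shift t A) (p + t) (q + t) :=
  Relation.ReflTransGen.lift (· + t) (fun a b h => by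
    refine ⟨?_, ?_, near_add_right_iff.2 h.2.2⟩ <;> rw [mem_shift, add_sub_cancel_right]
    exacts [h.1, h.2.1]) _ _ h

theorem shift_mem_components {A T : Finset (Fin d → ℤ)} (h : T ∈ components A) (t : Fin d → ℤ) :
    shift t T ∈ components (shift t A) := by
  obtain ⟨p, hp, hT⟩ := mem_components.1 h
  refine mem_components.2 ⟨p + t, by rwa [mem_shift, add_sub_cancel_right], fun q => ?_⟩
  rw [mem_shift, mem_shift, hT]
  refine and_congr_right fun _ => ⟨fun h => by simpa using h.shift t, fun h => ?_⟩
  have h1 := h.shift (-t)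
  rw [shift_shift, add_neg_cancel, shift_zero] at h1
  simpa [sub_eq_add_neg] using h1

end Lattice

/-! ### Approximation of a fractal cube by lattice points -/

section Subdivision

variable {d n : ℕ} (D : Finset (Fin d → Fin n))

/-- The lattice points `n * p + δ` with `p ∈ S` and `δ ∈ D`: subdivision of the cubes attached to
`S`, rescaled by `n`. -/
def subdivide (S : Finset (Fin d → ℤ)) : Finset (Fin d → ℤ) :=
  (S ×ˢ D).image fun p i => n * p.1 i + ((p.2 i : ℕ) : ℤ)

variable {D}

theorem mem_subdivide {S : Finset (Fin d → ℤ)} {q : Fin d → ℤ} :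
    q ∈ subdivide D S ↔ ∃ p ∈ S, ∃ δ ∈ D, q = fun i => n * p i + ((δ i : ℕ) : ℤ) := by
  simp only [subdivide, Finset.mem_image, Finset.mem_product, Prod.exists]
  constructor
  · rintro ⟨p, δ, ⟨hp, hδ⟩, rfl⟩
    exact ⟨p, hp, δ, hδ, rfl⟩
  · rintro ⟨p, hp, δ, hδ, rfl⟩
    exact ⟨p, δ, ⟨hp, hδ⟩, rfl⟩

theorem near_of_near_subdivide {p p' : Fin d → ℤ} {δ δ' : Fin d → Fin n}
    (h : Near (fun i => n * p i + ((δ i : ℕ) : ℤ)) fun i => n * p' i + ((δ' i : ℕ) : ℤ)) :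
    Near p p' := by
  intro i
  have h1 := abs_le.1 (h i)
  have h2 := (δ i).2
  have h3 := (δ' i).2
  have hn : (0 : ℤ) < n := by omega
  have h2' : ((δ i : ℕ) : ℤ) < n := by exact_mod_cast h2
  have h3' : ((δ' i : ℕ) : ℤ) < n := by exact_mod_cast h3
  rw [abs_le]
  constructor
  · by_contra! hlt
    nlinarith
  · by_contra! hlt
    nlinarith

theorem subdivide_injective {p p' : Fin d → ℤ} {δ δ' : Fin d → Fin n}
    (h : (fun i => n * p i + ((δ i : ℕ) : ℤ)) = fun i => n * p' i + ((δ' i : ℕ) : ℤ)) :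
    p = p' ∧ δ = δ' := by
  have key : ∀ i, p i = p' i ∧ δ i = δ' i := by
    intro i
    have h1 := congrFun h i
    have h2 := (δ i).2
    have h3 := (δ' i).2
    have hn : (0 : ℤ) < n := by omega
    have h2' : ((δ i : ℕ) : ℤ) < n := by exact_mod_cast h2
    have h3' : ((δ' i : ℕ) : ℤ) < n := by exact_mod_cast h3
    have h4 : p i = p' i := by
      rcases lt_trichotomy (p i) (p' i) with hlt | heq | hlt
      · nlinarith
      · exact heq
      · nlinarith
    rw [h4] at h1
    exact ⟨h4, Fin.ext (by omega)⟩
  exact ⟨funext fun i => (key i).1, funext fun i => (key i).2⟩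

theorem card_subdivide (S : Finset (Fin d → ℤ)) : (subdivide D S).card = D.card * S.card := by
  rw [subdivide, Finset.card_image_of_injective, Finset.card_product, mul_comm]
  rintro ⟨p, δ⟩ ⟨p', δ'⟩ h
  obtain ⟨h1, h2⟩ := subdivide_injective h
  exact Prod.ext h1 h2

theorem disjoint_subdivide {S S' : Finset (Fin d → ℤ)} (h : Disjoint S S') :
    Disjoint (subdivide D S) (subdivide D S') := by
  refine Finset.disjoint_left.2 fun q hq hq' => ?_
  obtain ⟨p, hp, δ, -, rfl⟩ := mem_subdivide.1 hq
  obtain ⟨p', hp', δ', -, he⟩ := mem_subdivide.1 hq'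
  rw [(subdivide_injective he).1] at hp
  exact Finset.disjoint_left.1 h hp hp'

theorem subdivide_mono {S S' : Finset (Fin d → ℤ)} (h : S ⊆ S') :
    subdivide D S ⊆ subdivide D S' := by
  intro q hq
  obtain ⟨p, hp, δ, hδ, rfl⟩ := mem_subdivide.1 hq
  exact mem_subdivide.2 ⟨p, h hp, δ, hδ, rfl⟩

theorem subdivide_shift (t : Fin d → ℤ) (S : Finset (Fin d → ℤ)) :
    subdivide D (shift t S) = shift ((n : ℤ) • t) (subdivide D S) := by
  ext q
  rw [mem_shift]
  simp only [mem_subdivide, mem_shift]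
  constructor
  · rintro ⟨p, hp, δ, hδ, rfl⟩
    refine ⟨p - t, hp, δ, hδ, funext fun i => ?_⟩
    simp only [Pi.sub_apply, Pi.smul_apply, smul_eq_mul]
    ring
  · rintro ⟨p, hp, δ, hδ, h⟩
    refine ⟨p + t, by simpa using hp, δ, hδ, funext fun i => ?_⟩
    have h1 := congrFun h i
    simp only [Pi.sub_apply, Pi.smul_apply, smul_eq_mul] at h1
    simp only [Pi.add_apply]
    linarith

/-- The points of the `k`-fold subdivision are the points `n ^ k * p + e` with `p ∈ S` and `e` in
the `k`-fold subdivision of the origin. -/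
theorem mem_iterate_subdivide (k : ℕ) {S : Finset (Fin d → ℤ)} {q : Fin d → ℤ} :
    q ∈ (subdivide D)^[k] S ↔
      ∃ p ∈ S, ∃ e ∈ (subdivide D)^[k] {0}, q = fun i => n ^ k * p i + e i := by
  induction k generalizing q with
  | zero =>
    simp only [Function.iterate_zero, id_eq, Finset.mem_singleton, pow_zero, one_mul]
    constructor
    · intro h
      exact ⟨q, h, 0, rfl, by ext i; simp⟩
    · rintro ⟨p, hp, _, rfl, rfl⟩
      simpa using hp
  | succ k ih =>
    rw [Function.iterate_succ_apply', Function.iterate_succ_apply', mem_subdivide]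
    simp only [ih]
    constructor
    · rintro ⟨_, ⟨p, hp, e, he, rfl⟩, δ, hδ, rfl⟩
      refine ⟨p, hp, fun i => n * e i + ((δ i : ℕ) : ℤ),
        mem_subdivide.2 ⟨e, he, δ, hδ, rfl⟩, funext fun i => ?_⟩
      ring
    · rintro ⟨p, hp, e, he, rfl⟩
      obtain ⟨e', he', δ, hδ, rfl⟩ := mem_subdivide.1 he
      refine ⟨_, ⟨p, hp, e', he', rfl⟩, δ, hδ, funext fun i => ?_⟩
      ring

theorem iterate_subdivide_bounds {k : ℕ} {e : Fin d → ℤ} (he : e ∈ (subdivide D)^[k] {0})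
    (i : Fin d) : 0 ≤ e i ∧ e i < n ^ k := by
  induction k generalizing e with
  | zero =>
    simp only [Function.iterate_zero, id_eq, Finset.mem_singleton] at he
    simp [he]
  | succ k ih =>
    rw [Function.iterate_succ_apply', mem_subdivide] at he
    obtain ⟨p, hp, δ, -, rfl⟩ := he
    obtain ⟨h1, h2⟩ := ih hp
    have h3 : ((δ i : ℕ) : ℤ) < n := by exact_mod_cast (δ i).2
    have h4 : (0 : ℤ) ≤ (δ i : ℕ) := by positivity
    constructor
    · positivity
    · rw [pow_succ]
      nlinarith

variable (D) in
/-- The clusters into which the subdivision of a cluster `S` decomposes. -/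
noncomputable def clusters (S : Finset (Fin d → ℤ)) : Finset (Finset (Fin d → ℤ)) :=
  components (subdivide D S)

theorem shift_mem_clusters {S T : Finset (Fin d → ℤ)} (h : T ∈ clusters D S) (t : Fin d → ℤ) :
    shift ((n : ℤ) • t) T ∈ clusters D (shift t S) := by
  rw [clusters, subdivide_shift]
  exact shift_mem_components h _

theorem sum_card_clusters (S : Finset (Fin d → ℤ)) :
    ∑ T ∈ clusters D S, T.card = D.card * S.card := by
  classical
  rw [← card_subdivide]
  have h : (clusters D S).biUnion id = subdivide D S := by
    ext q
    simp only [Finset.mem_biUnion, id_eq]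
    exact ⟨fun ⟨T, hT, hq⟩ => subset_of_mem_components hT hq, fun hq => exists_mem_components hq⟩
  rw [← h, Finset.card_biUnion]
  · rfl
  · intro T hT T' hT' hne
    refine Finset.disjoint_left.2 fun q hq hq' => hne ?_
    exact eq_of_near_of_mem_components hT hT' hq hq' fun i => by simp

theorem nonempty_of_mem_descendants {k : ℕ} {S T : Finset (Fin d → ℤ)} (hS : S.Nonempty)
    (h : T ∈ descendants (clusters D) k S) : T.Nonempty := by
  cases k with
  | zero => rw [mem_descendants_zero] at h; exact h ▸ hS
  | succ k =>
    obtain ⟨w, -, h⟩ := mem_descendants_succ.1 h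
    exact nonempty_of_mem_components h

theorem subset_iterate_subdivide {k : ℕ} {S T : Finset (Fin d → ℤ)}
    (h : T ∈ descendants (clusters D) k S) : T ⊆ (subdivide D)^[k] S := by
  induction k generalizing T with
  | zero => rw [mem_descendants_zero] at h; rw [h]; exact subset_rfl
  | succ k ih =>
    obtain ⟨w, hw, h⟩ := mem_descendants_succ.1 h
    rw [Function.iterate_succ_apply']
    exact (subset_of_mem_components h).trans (subdivide_mono (ih hw))

/-- Clusters of the same generation that have near points coincide. -/
theorem eq_of_near_of_mem_descendants {k : ℕ} {S T T' : Finset (Fin d → ℤ)}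
    (hT : T ∈ descendants (clusters D) k S) (hT' : T' ∈ descendants (clusters D) k S)
    {p q : Fin d → ℤ} (hp : p ∈ T) (hq : q ∈ T') (h : Near p q) : T = T' := by
  induction k generalizing T T' p q with
  | zero =>
    rw [mem_descendants_zero] at hT hT'
    rw [hT, hT']
  | succ k ih =>
    obtain ⟨w, hw, hT⟩ := mem_descendants_succ.1 hT
    obtain ⟨w', hw', hT'⟩ := mem_descendants_succ.1 hT'
    obtain ⟨a, ha, δ, -, rfl⟩ := mem_subdivide.1 (subset_of_mem_components hT hp)
    obtain ⟨b, hb, δ', -, rfl⟩ := mem_subdivide.1 (subset_of_mem_components hT' hq)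
    obtain rfl := ih hw hw' ha hb (near_of_near_subdivide h)
    exact eq_of_near_of_mem_components hT hT' hp hq h

end Subdivision

/-! ### Cells of the attractor -/

section Cells

variable {d n : ℕ}

/-- The union of the copies `(p + E) / n ^ k` of `E` with `p ∈ S`. -/
def cells (E : Set (EuclideanSpace ℝ (Fin d))) (n k : ℕ) (S : Finset (Fin d → ℤ)) :
    Set (EuclideanSpace ℝ (Fin d)) :=
  {x | ∃ p ∈ S, ∃ z ∈ E, ∀ i, x i = (p i + z i) / n ^ k}

variable {E : Set (EuclideanSpace ℝ (Fin d))} {D : Finset (Fin d → Fin n)}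

theorem cubeMap_apply (δ : Fin d → Fin n) (x : EuclideanSpace ℝ (Fin d)) (i : Fin d) :
    cubeMap δ x i = (x i + (δ i : ℕ)) / n := by
  simp [cubeMap, div_eq_inv_mul, mul_add]

theorem mem_attractor_iff (hE : IsAttractor (fun δ : D => cubeMap (δ : Fin d → Fin n)) E)
    {x : EuclideanSpace ℝ (Fin d)} :
    x ∈ E ↔ ∃ δ ∈ D, ∃ z ∈ E, ∀ i, x i = (z i + (δ i : ℕ)) / n := by
  conv_lhs => rw [hE.2.2]
  simp only [Set.mem_iUnion, Set.mem_image, Subtype.exists]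
  constructor
  · rintro ⟨δ, hδ, z, hz, rfl⟩
    exact ⟨δ, hδ, z, hz, fun i => cubeMap_apply δ z i⟩
  · rintro ⟨δ, hδ, z, hz, h⟩
    refine ⟨δ, hδ, z, hz, ?_⟩
    ext i
    rw [cubeMap_apply, h]

theorem cells_zero_singleton : cells E n 0 {0} = E := by
  ext x
  simp only [cells, Finset.mem_singleton, exists_eq_left, Pi.zero_apply, Int.cast_zero, zero_add,
    pow_zero, div_one, Set.mem_ofPred_eq]
  constructor
  · rintro ⟨z, hz, h⟩
    have : x = z := by ext i; exact h i
    rwa [this]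
  · exact fun h => ⟨x, h, fun _ => rfl⟩

theorem cells_subdivide (hn : 2 ≤ n)
    (hE : IsAttractor (fun δ : D => cubeMap (δ : Fin d → Fin n)) E) (k : ℕ)
    (S : Finset (Fin d → ℤ)) : cells E n (k + 1) (subdivide D S) = cells E n k S := by
  have hn0 : (n : ℝ) ≠ 0 := by positivity
  ext x
  constructor
  · rintro ⟨q, hq, z, hz, hx⟩
    obtain ⟨p, hp, δ, hδ, rfl⟩ := mem_subdivide.1 hq
    refine ⟨p, hp, WithLp.toLp 2 fun i => (z i + (δ i : ℕ)) / n,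
      (mem_attractor_iff hE).2 ⟨δ, hδ, z, hz, fun i => rfl⟩, fun i => ?_⟩
    rw [hx]
    push_cast
    field_simp
    ring
  · rintro ⟨p, hp, z, hz, hx⟩
    obtain ⟨δ, hδ, w, hw, hz⟩ := (mem_attractor_iff hE).1 hz
    refine ⟨_, mem_subdivide.2 ⟨p, hp, δ, hδ, rfl⟩, w, hw, fun i => ?_⟩
    rw [hx, hz]
    push_cast
    field_simp
    ring

theorem cells_iterate_subdivide (hn : 2 ≤ n)
    (hE : IsAttractor (fun δ : D => cubeMap (δ : Fin d → Fin n)) E) (k j : ℕ)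
    (S : Finset (Fin d → ℤ)) : cells E n (k + j) ((subdivide D)^[j] S) = cells E n k S := by
  induction j with
  | zero => rfl
  | succ j ih => rw [Function.iterate_succ_apply', ← add_assoc, cells_subdivide hn hE, ih]

theorem cells_mono {k : ℕ} {S S' : Finset (Fin d → ℤ)} (h : S ⊆ S') :
    cells E n k S ⊆ cells E n k S' := fun _ ⟨p, hp, z, hz, hx⟩ => ⟨p, h hp, z, hz, hx⟩

theorem cells_eq_iUnion_clusters (hn : 2 ≤ n)
    (hE : IsAttractor (fun δ : D => cubeMap (δ : Fin d → Fin n)) E) (k : ℕ)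
    (S : Finset (Fin d → ℤ)) :
    cells E n k S = ⋃ T ∈ clusters D S, cells E n (k + 1) T := by
  rw [← cells_subdivide hn hE]
  ext x
  simp only [Set.mem_iUnion]
  constructor
  · rintro ⟨p, hp, h⟩
    obtain ⟨T, hT, hpT⟩ := exists_mem_components hp
    exact ⟨T, hT, p, hpT, h⟩
  · rintro ⟨T, hT, p, hp, h⟩
    exact ⟨p, subset_of_mem_components hT hp, h⟩

theorem cells_eq_iUnion_descendants (hn : 2 ≤ n)
    (hE : IsAttractor (fun δ : D => cubeMap (δ : Fin d → Fin n)) E) (k m : ℕ)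
    (S : Finset (Fin d → ℤ)) :
    cells E n k S = ⋃ T ∈ descendants (clusters D) m S, cells E n (k + m) T := by
  induction m with
  | zero => ext x; simp [mem_descendants_zero]
  | succ m ih =>
    rw [ih]
    ext x
    simp only [Set.mem_iUnion, mem_descendants_succ, exists_prop]
    constructor
    · rintro ⟨T, hT, hx⟩
      rw [cells_eq_iUnion_clusters hn hE] at hx
      simp only [Set.mem_iUnion, exists_prop] at hx
      obtain ⟨T', hT', hx⟩ := hx
      exact ⟨T', ⟨T, hT, hT'⟩, hx⟩
    · rintro ⟨T', ⟨T, hT, hT'⟩, hx⟩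
      refine ⟨T, hT, ?_⟩
      rw [cells_eq_iUnion_clusters hn hE]
      simp only [Set.mem_iUnion, exists_prop]
      exact ⟨T', hT', hx⟩

theorem isCompact_cells (hE : IsCompact E) (k : ℕ) (S : Finset (Fin d → ℤ)) :
    IsCompact (cells E n k S) := by
  have h : cells E n k S = ⋃ p ∈ S, (fun z : EuclideanSpace ℝ (Fin d) =>
      ((n : ℝ) ^ k)⁻¹ • (WithLp.toLp 2 (fun i => (p i : ℝ)) + z)) '' E := by
    ext x
    simp only [cells, Set.mem_ofPred_eq, Set.mem_iUnion, Set.mem_image, exists_prop]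
    refine exists_congr fun p => and_congr_right fun _ => exists_congr fun z =>
      and_congr_right fun _ => ?_
    constructor
    · intro h
      ext i
      rw [h]
      simp [div_eq_inv_mul, mul_add]
    · rintro rfl i
      simp [div_eq_inv_mul, mul_add]
  rw [h]
  exact S.finite_toSet.isCompact_biUnion fun p _ => hE.image (by fun_prop)

theorem clopenSeparated_cells_zero (hE : IsCompact E) (hE' : IsTotallyDisconnected E)
    (S : Finset (Fin d → ℤ)) : ClopenSeparated (cells E n 0 S) := by
  have h : cells E n 0 S = ⋃ p ∈ S,
      Homeomorph.addLeft (WithLp.toLp 2 (fun i => (p i : ℝ)) : EuclideanSpace ℝ (Fin d)) '' E := by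
    ext x
    simp only [cells, Set.mem_ofPred_eq, Set.mem_iUnion, Set.mem_image, exists_prop]
    refine exists_congr fun p => and_congr_right fun _ => exists_congr fun z =>
      and_congr_right fun _ => ?_
    constructor
    · intro h
      ext i
      rw [h]
      simp
    · rintro rfl i
      simp
  rw [h]
  refine ClopenSeparated.biUnion S _ fun p _ => ?_
  refine IsTotallyDisconnected.clopenSeparated ?_ (hE.image (Homeomorph.continuous _))
  exact (Homeomorph.isEmbedding _).isTotallyDisconnected_image.2 hE'

theorem attractor_subset_unit_cube (hn : 2 ≤ n)
    (hE : IsAttractor (fun δ : D => cubeMap (δ : Fin d → Fin n)) E)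
    {x : EuclideanSpace ℝ (Fin d)} (hx : x ∈ E) (i : Fin d) : 0 ≤ x i ∧ x i ≤ 1 := by
  have hn2 : (2 : ℝ) ≤ n := by exact_mod_cast hn
  have hcont : ContinuousOn (fun z : EuclideanSpace ℝ (Fin d) => z i) E := by fun_prop
  obtain ⟨a, ha, hmin⟩ := hE.2.1.exists_isMinOn hE.1 hcont
  obtain ⟨b, hb, hmax⟩ := hE.2.1.exists_isMaxOn hE.1 hcont
  obtain ⟨δ, -, z, hz, haz⟩ := (mem_attractor_iff hE).1 ha
  obtain ⟨δ', -, z', hz', hbz⟩ := (mem_attractor_iff hE).1 hb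
  have h1 : a i ≤ z i := hmin hz
  have h2 : z' i ≤ b i := hmax hz'
  have h3 : a i ≤ x i := hmin hx
  have h4 : x i ≤ b i := hmax hx
  have h5 := haz i
  have h6 := hbz i
  rw [eq_div_iff (by positivity)] at h5 h6
  have h7 : (0 : ℝ) ≤ (δ i : ℕ) := by positivity
  have h8 : ((δ' i : ℕ) : ℝ) ≤ n - 1 := by
    have : (δ' i : ℕ) + 1 ≤ n := (δ' i).2
    have : (((δ' i : ℕ) + 1 : ℕ) : ℝ) ≤ n := by exact_mod_cast this
    push_cast at this
    linarith
  constructor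
  · nlinarith
  · nlinarith

theorem dist_le_of_abs_le {x y : EuclideanSpace ℝ (Fin d)} {R : ℝ} (hR : 0 ≤ R)
    (h : ∀ i, |x i - y i| ≤ R) : dist x y ≤ d * R := by
  rw [EuclideanSpace.dist_eq]
  refine Real.sqrt_le_iff.2 ⟨by positivity, ?_⟩
  have h1 : ∑ i, dist (x i) (y i) ^ 2 ≤ ∑ _i : Fin d, R ^ 2 := by
    refine Finset.sum_le_sum fun i _ => ?_
    rw [Real.dist_eq]
    exact pow_le_pow_left₀ (abs_nonneg _) (h i) 2
  refine h1.trans ?_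
  rw [Finset.sum_const, Finset.card_univ, Fintype.card_fin, nsmul_eq_mul, mul_pow]
  refine mul_le_mul_of_nonneg_right ?_ (sq_nonneg R)
  exact_mod_cast Nat.le_self_pow two_ne_zero d

theorem abs_sub_le_dist (x y : EuclideanSpace ℝ (Fin d)) (i : Fin d) :
    |x i - y i| ≤ dist x y := by
  rw [dist_eq_norm, ← Real.norm_eq_abs]
  exact PiLp.norm_apply_le (x - y) i

end Cells

/-! ### Boundedness of clusters and coding of fractal cubes -/

section Bounded

variable {d n : ℕ} {E : Set (EuclideanSpace ℝ (Fin d))} {D : Finset (Fin d → Fin n)}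

/-- Consider the union `Y` of all translates of `E` by vectors with coordinates in `{-1, 0, 1}`.
At a fine enough scale no chain of near lattice points of `Y` leads from `E` to the boundary of the
cube `[-1, 2]ᵈ`: the set `C` consists of lattice points of the part of `Y` that is separated
from the rest by a clopen set. -/
theorem exists_insulation (hn : 2 ≤ n)
    (hE : IsAttractor (fun δ : D => cubeMap (δ : Fin d → Fin n)) E)
    (hE' : IsTotallyDisconnected E) : ∃ k, 1 ≤ k ∧ ∃ C : Set (Fin d → ℤ),
      (∀ p ∈ (subdivide D)^[k] {0}, p ∈ C) ∧
      (∀ p ∈ C, ∀ i, -(n : ℤ) ^ k + 1 ≤ p i ∧ p i + 2 ≤ 2 * n ^ k) ∧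
      ∀ p ∈ C, ∀ q ∈ (subdivide D)^[k] (Finset.Icc (-1) 1), Near p q → q ∈ C := by
  set H : Finset (Fin d → ℤ) := Finset.Icc (-1) 1 with hH
  set Y := cells E n 0 H with hY
  have hYc : IsCompact Y := isCompact_cells hE.2.1 0 H
  have hunit : ∀ z ∈ E, ∀ i, 0 ≤ z i ∧ z i ≤ 1 := fun z hz =>
    attractor_subset_unit_cube hn hE hz
  have hEY : E ⊆ Y := by
    have h : cells E n 0 {0} ⊆ Y := by
      refine cells_mono ?_
      rw [Finset.singleton_subset_iff, hH, Finset.mem_Icc]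
      exact ⟨fun i => by simp, fun i => by simp⟩
    rwa [cells_zero_singleton] at h
  let U : Set (EuclideanSpace ℝ (Fin d)) := ⋂ i,
    (fun x : EuclideanSpace ℝ (Fin d) => x i) ⁻¹' Set.Ioo (-(1 / 2)) (3 / 2)
  have hU : IsOpen U := isOpen_iInter_of_finite fun i =>
    isOpen_Ioo.preimage (by fun_prop)
  obtain ⟨W, hWY, hW, hW', hEW, hWU⟩ := clopenSeparated_cells_zero hE.2.1 hE' H E U
    hE.2.1.isClosed hU (fun z hz => Set.mem_iInter.2 fun i => by
      have := hunit z hz i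
      exact ⟨by linarith, by linarith⟩)
  obtain ⟨η, hη, hsep⟩ := Metric.exists_pos_forall_lt_edist (hYc.of_isClosed_subset hW hWY) hW'
    Set.disjoint_sdiff_right
  have hn1 : (1 : ℝ) < n := by exact_mod_cast hn
  -- A scale at which near lattice points are closer than the distance of the two parts of `Y`.
  obtain ⟨k₀, hk₀⟩ := pow_unbounded_of_one_lt ((d + 1 : ℝ) * 2 / η) hn1
  set k := k₀ + 2 with hk
  have hnk : (0 : ℝ) < n ^ k := by positivity
  have hk4 : (4 : ℤ) ≤ n ^ k := by
    have h1 : 4 ≤ n ^ 2 := by nlinarith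
    have h2 : n ^ 2 ≤ n ^ k := Nat.pow_le_pow_right (by omega) (by omega)
    exact_mod_cast h1.trans h2
  have hk4' : (4 : ℝ) ≤ n ^ k := by exact_mod_cast hk4
  have hscale : (d : ℝ) * (2 / n ^ k) < η := by
    have h1 : (n : ℝ) ^ k₀ ≤ n ^ k := pow_le_pow_right₀ hn1.le (by omega)
    have hη' : (0 : ℝ) < η := hη
    rw [← mul_div_assoc, div_lt_iff₀ hnk]
    rw [div_lt_iff₀ hη'] at hk₀
    have h2 := mul_le_mul_of_nonneg_left h1 hη'.le
    linarith
  obtain ⟨z, hz⟩ := hE.1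
  have hzu := hunit z hz
  let pt : (Fin d → ℤ) → EuclideanSpace ℝ (Fin d) := fun p =>
    WithLp.toLp 2 fun i => (p i + z i) / n ^ k
  have hpt : ∀ p i, pt p i = (p i + z i) / n ^ k := fun p i => rfl
  have hptY : ∀ p ∈ (subdivide D)^[k] H, pt p ∈ Y := by
    intro p hp
    have h := cells_iterate_subdivide hn hE 0 k H
    rw [zero_add] at h
    rw [hY, ← h]
    exact ⟨p, hp, z, hz, hpt p⟩
  refine ⟨k, by omega, {p | pt p ∈ W}, fun p hp => ?_, fun p hp i => ?_, fun p hp q hq hpq => ?_⟩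
  · have h := cells_iterate_subdivide hn hE 0 k {0}
    rw [zero_add, cells_zero_singleton] at h
    have hpE : pt p ∈ E := by
      rw [← h]
      exact ⟨p, hp, z, hz, hpt p⟩
    exact hEW ⟨hpE, hEY hpE⟩
  · have h := Set.mem_iInter.1 (hWU hp) i
    have h1 : -(1 / 2 : ℝ) < pt p i := h.1
    have h2 : pt p i < 3 / 2 := h.2
    rw [hpt, lt_div_iff₀ hnk] at h1
    rw [hpt, div_lt_iff₀ hnk] at h2
    have h3 := hzu i
    constructor
    · have h4 : ((-(n : ℤ) ^ k : ℤ) : ℝ) < p i := by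
        push_cast
        linarith
      have h5 : -(n : ℤ) ^ k < p i := by exact_mod_cast h4
      omega
    · have h4 : ((p i + 1 : ℤ) : ℝ) < ((2 * n ^ k : ℤ) : ℝ) := by
        push_cast
        linarith
      have h5 : p i + 1 < 2 * (n : ℤ) ^ k := by exact_mod_cast h4
      omega
  · by_contra hqW
    have h1 := hsep (pt p) hp (pt q) ⟨hptY q hq, hqW⟩
    have h2 : dist (pt p) (pt q) ≤ d * (2 / n ^ k) := by
      refine dist_le_of_abs_le (by positivity) fun i => ?_
      rw [hpt, hpt, ← sub_div, abs_div, abs_of_pos hnk]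
      refine div_le_div_of_nonneg_right ?_ hnk.le
      have h3 : |((p i - q i : ℤ) : ℝ)| ≤ 1 := by exact_mod_cast hpq i
      push_cast at h3
      rw [add_sub_add_right_eq_sub]
      linarith
    rw [edist_dist, ← ENNReal.ofReal_coe_nnreal] at h1
    have h3 := (ENNReal.ofReal_lt_ofReal_iff_of_nonneg η.coe_nonneg).1 h1
    linarith

/-- The clusters of a totally disconnected fractal cube have bounded extent: by
`exists_insulation`, a cluster meeting a cube of an earlier generation does not leave the
neighbouring cubes. -/
theorem exists_cluster_bound (hn : 2 ≤ n)
    (hE : IsAttractor (fun δ : D => cubeMap (δ : Fin d → Fin n)) E)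
    (hE' : IsTotallyDisconnected E) : ∃ B : ℤ, ∀ k, ∀ S ∈ descendants (clusters D) k {0},
      ∃ t : Fin d → ℤ, ∀ p ∈ S, ∀ i, |p i - t i| ≤ B := by
  obtain ⟨k, hk, C, hC0, hCb, hCn⟩ := exists_insulation hn hE hE'
  have hnk : (0 : ℤ) < n ^ k := by positivity
  refine ⟨2 * n ^ k, fun l S hS => ?_⟩
  rcases lt_or_ge l k with hlk | hkl
  · refine ⟨0, fun p hp i => ?_⟩
    obtain ⟨h1, h2⟩ := iterate_subdivide_bounds (subset_iterate_subdivide hS hp) i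
    have h3 : (n : ℤ) ^ l ≤ n ^ k := by
      exact_mod_cast Nat.pow_le_pow_right (by omega) hlk.le
    rw [Pi.zero_apply, sub_zero, abs_le]
    constructor <;> linarith
  obtain ⟨l, rfl⟩ := Nat.exists_eq_add_of_le' hkl
  obtain ⟨p₀, hp₀⟩ := nonempty_of_mem_descendants (Finset.singleton_nonempty 0) hS
  have hmem : ∀ q ∈ (subdivide D)^[l + k] {0}, ∃ r : Fin d → ℤ, ∃ e ∈ (subdivide D)^[k] {0},
      q = fun i => n ^ k * r i + e i := by
    intro q hq
    rw [add_comm, Function.iterate_add_apply, mem_iterate_subdivide] at hq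
    obtain ⟨r, -, e, he, h⟩ := hq
    exact ⟨r, e, he, h⟩
  obtain ⟨r₀, e₀, he₀, hpe₀⟩ := hmem p₀ (subset_iterate_subdivide hS hp₀)
  refine ⟨fun i => n ^ k * r₀ i, fun p hp i => ?_⟩
  obtain ⟨A, hA, hp₀p⟩ : ∃ A ⊆ (subdivide D)^[l + k] {0}, Linked A p₀ p := by
    obtain ⟨j, hj⟩ : ∃ j, l + k = j + 1 := ⟨l + k - 1, by omega⟩
    rw [hj] at hS ⊢
    obtain ⟨w, hw, hS⟩ := mem_descendants_succ.1 hS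
    refine ⟨subdivide D w, ?_, linked_of_mem_components hS hp₀ hp⟩
    rw [Function.iterate_succ_apply']
    exact subdivide_mono (subset_iterate_subdivide hw)
  have key : ∀ q, Linked A p₀ q → (fun i => q i - n ^ k * r₀ i) ∈ C := by
    intro q hq
    induction hq with
    | refl =>
      have h : (fun i => p₀ i - n ^ k * r₀ i) = e₀ := by
        rw [hpe₀]
        ext i
        simp
      rw [h]
      exact hC0 _ he₀
    | @tail a b _ hab ih =>
      obtain ⟨r, e, he, rfl⟩ := hmem b (hA hab.2.1)
      refine hCn _ ih _ ?_ fun i => ?_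
      · refine (mem_iterate_subdivide k).2 ⟨r - r₀, ?_, e, he, funext fun i => ?_⟩
        · have hr : ∀ i, -1 ≤ r i - r₀ i ∧ r i - r₀ i ≤ 1 := by
            intro i
            have h1 := hCb _ ih i
            have h2 := abs_le.1 (hab.2.2 i)
            have h3 := iterate_subdivide_bounds he i
            simp only at h1 h2
            constructor
            · by_contra! hlt
              nlinarith
            · by_contra! hlt
              nlinarith
          rw [Finset.mem_Icc]
          exact ⟨fun i => (hr i).1, fun i => (hr i).2⟩
        · simp only [Pi.sub_apply]
          ring
      · have h := hab.2.2 i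
        simp only at h ⊢
        rwa [sub_sub_sub_cancel_right]
  have h := hCb _ (key p hp₀p) i
  simp only at h ⊢
  rw [abs_le]
  constructor <;> linarith
/-- The tree of clusters of a fractal cube, typed by the translation classes of clusters: the type of
a cluster is the set of its translates that are contained in a fixed finite box. -/
theorem exists_typedTree (hn : 2 ≤ n)
    (hE : IsAttractor (fun δ : D => cubeMap (δ : Fin d → Fin n)) E)
    (hE' : IsTotallyDisconnected E) : ∃ (K : Type) (_ : Finite K) (M : ℕ)
      (T : TypedTree (Finset (Fin d → ℤ)) K D.card M), T.ch = clusters D ∧ T.wt = Finset.card ∧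
        ∀ S, T.good S ↔ ∃ k, S ∈ descendants (clusters D) k {0} := by
  classical
  obtain ⟨B, hB⟩ := exists_cluster_bound hn hE hE'
  let Box : Finset (Fin d → ℤ) := Finset.Icc (fun _ => -B) fun _ => B
  have hbox : ∀ k, ∀ S ∈ descendants (clusters D) k {0}, ∃ t, shift t S ⊆ Box := by
    intro k S hS
    obtain ⟨t, ht⟩ := hB k S hS
    refine ⟨-t, fun q hq => ?_⟩
    rw [mem_shift, sub_neg_eq_add] at hq
    have h := fun i => abs_le.1 (ht _ hq i)
    simp only [Pi.add_apply, add_sub_cancel_right] at h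
    exact Finset.mem_Icc.2 ⟨fun i => (h i).1, fun i => (h i).2⟩
  let ty : Finset (Fin d → ℤ) → {κ // κ ∈ Box.powerset.powerset} := fun S =>
    ⟨{S' ∈ Box.powerset | ∃ t, S' = shift t S},
      Finset.mem_powerset.2 (Finset.filter_subset _ _)⟩
  have hty : ∀ t S, ty (shift t S) = ty S := by
    intro t S
    refine Subtype.ext (Finset.filter_congr fun S' _ => ⟨?_, ?_⟩)
    · rintro ⟨s, rfl⟩
      exact ⟨t + s, shift_shift s t S⟩
    · rintro ⟨s, rfl⟩
      exact ⟨s - t, by rw [shift_shift, add_sub_cancel]⟩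
  have hshift : ∀ k S S', S ∈ descendants (clusters D) k {0} → ty S = ty S' →
      ∃ t, S' = shift t S := by
    intro k S S' hS h
    obtain ⟨t, ht⟩ := hbox k S hS
    have h1 : shift t S ∈ (ty S).1 := Finset.mem_filter.2 ⟨Finset.mem_powerset.2 ht, t, rfl⟩
    rw [h] at h1
    obtain ⟨-, s, hs⟩ := Finset.mem_filter.1 h1
    exact ⟨t - s, by rw [sub_eq_add_neg, ← shift_shift, hs, shift_shift, add_neg_cancel, shift_zero]⟩
  refine ⟨{κ // κ ∈ Box.powerset.powerset}, inferInstance, Box.card, ?_, ?_⟩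
  · refine
      { ch := clusters D
        ty := ty
        wt := Finset.card
        good := fun S => ∃ k, S ∈ descendants (clusters D) k {0}
        apart := Disjoint
        good_ch := fun ⟨k, hk⟩ h => ⟨k + 1, mem_descendants_succ.2 ⟨_, hk, h⟩⟩
        wt_pos := fun ⟨k, hk⟩ => Finset.card_pos.2
          (nonempty_of_mem_descendants (Finset.singleton_nonempty 0) hk)
        wt_le := ?_
        sum_wt := fun _ => sum_card_clusters _
        wt_congr := ?_
        ch_congr := ?_
        apart_irrefl := ?_
        apart_ch := fun h h1 h2 => Finset.disjoint_of_subset_left (subset_of_mem_components h1)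
          (Finset.disjoint_of_subset_right (subset_of_mem_components h2) (disjoint_subdivide h))
        apart_of_mem_ch := ?_ }
    · rintro S ⟨k, hk⟩
      obtain ⟨t, ht⟩ := hbox k S hk
      rw [← card_shift t]
      exact Finset.card_le_card ht
    · rintro S S' ⟨k, hk⟩ - h
      obtain ⟨t, rfl⟩ := hshift k S S' hk h
      rw [card_shift]
    · rintro S S' T ⟨k, hk⟩ - h hT
      obtain ⟨t, rfl⟩ := hshift k S S' hk h
      exact ⟨_, shift_mem_clusters hT t, hty _ _⟩
    · rintro S ⟨k, hk⟩ h
      exact (nonempty_of_mem_descendants (Finset.singleton_nonempty 0) hk).ne_empty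
        (disjoint_self.1 h)
    · rintro S T T' - hT hT' hne
      refine Finset.disjoint_left.2 fun q hq hq' => hne ?_
      exact eq_of_near_of_mem_components hT hT' hq hq' fun i => by simp
  · exact ⟨rfl, rfl, fun _ => Iff.rfl⟩

theorem inv_pow_le_dist_of_not_near (hn : 2 ≤ n)
    (hE : IsAttractor (fun δ : D => cubeMap (δ : Fin d → Fin n)) E) {k : ℕ}
    {S S' : Finset (Fin d → ℤ)} (h : ∀ p ∈ S, ∀ q ∈ S', ¬ Near p q)
    {x y : EuclideanSpace ℝ (Fin d)} (hx : x ∈ cells E n k S) (hy : y ∈ cells E n k S') :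
    ((n : ℝ)⁻¹) ^ k ≤ dist x y := by
  obtain ⟨p, hp, z, hz, hx⟩ := hx
  obtain ⟨q, hq, w, hw, hy⟩ := hy
  have hpq := h p hp q hq
  simp only [Near, not_forall, not_le] at hpq
  obtain ⟨i, hi⟩ := hpq
  refine le_trans ?_ (abs_sub_le_dist x y i)
  have hnk : (0 : ℝ) < n ^ k := by positivity
  have h1 : (2 : ℝ) ≤ |(p i : ℝ) - q i| := by
    have : (2 : ℤ) ≤ |p i - q i| := hi
    exact_mod_cast this
  have h2 := attractor_subset_unit_cube hn hE hz i
  have h3 := attractor_subset_unit_cube hn hE hw i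
  have h4 : |w i - z i| ≤ 1 := abs_le.2 ⟨by linarith, by linarith⟩
  rw [hx, hy, ← sub_div, abs_div, abs_of_pos hnk, inv_pow, inv_eq_one_div]
  refine div_le_div_of_nonneg_right ?_ hnk.le
  have h5 := abs_sub_abs_le_abs_sub ((p i : ℝ) - q i) (w i - z i)
  rw [show (p i : ℝ) - q i - (w i - z i) = p i + z i - (q i + w i) by ring] at h5
  linarith

/-- A totally disconnected fractal cube is coded by the infinite words in its digits. -/
theorem hasCoding_attractor (hn : 2 ≤ n)
    (hE : IsAttractor (fun δ : D => cubeMap (δ : Fin d → Fin n)) E)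
    (hE' : IsTotallyDisconnected E) (hD : 2 ≤ D.card) : HasCoding E D.card := by
  obtain ⟨K, _, M, T, hch, hwt, hgood⟩ := exists_typedTree hn hE hE'
  obtain ⟨B, hB⟩ := exists_cluster_bound hn hE hE'
  obtain ⟨m, hm, A, hA1, hA⟩ := T.exists_matching hD
  rw [hch] at hA
  set N := D.card
  have : CompactSpace E := isCompact_iff_compactSpace.1 hE.2.1
  have hn0 : (0 : ℝ) < n := by positivity
  have hn1 : (1 : ℝ) < n := by exact_mod_cast hn
  have hρ0 : (0 : ℝ) < (n : ℝ)⁻¹ := by positivity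
  have hρ1 : (n : ℝ)⁻¹ < 1 := inv_lt_one_of_one_lt₀ hn1
  have hB0 : 0 ≤ B ∨ d = 0 := by
    rcases Nat.eq_zero_or_pos d with h | h
    · exact Or.inr h
    · obtain ⟨t, ht⟩ := hB 0 {0} (mem_descendants_zero.2 rfl)
      exact Or.inl ((abs_nonneg _).trans (ht 0 (Finset.mem_singleton_self 0) ⟨0, h⟩))
  have hCpos : (0 : ℝ) < (d : ℝ) * (2 * B + 1) + 1 := by
    rcases hB0 with h | h
    · have : (0 : ℝ) ≤ B := by exact_mod_cast h
      positivity
    · rw [h]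
      norm_num
  have hlev : ∀ k v u, v ∈ descendants (clusters D) (m * k) {0} →
      u ∈ descendants (clusters D) m v → u ∈ descendants (clusters D) (m * (k + 1)) {0} :=
    fun k v u hv hu => mem_descendants_add.2 ⟨v, hv, hu⟩
  have hsub : ∀ k v, v ∈ descendants (clusters D) k {0} → cells E n k v ⊆ E := by
    intro k v hv
    have h := cells_eq_iUnion_descendants hn hE 0 k {0}
    rw [cells_zero_singleton, zero_add] at h
    intro x hx
    rw [h]
    exact Set.mem_biUnion hv hx
  obtain ⟨Q₀, e, hQ₀, hinj, hrange, hdist⟩ := exists_coding_of_tree (X := E)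
    (descendants (clusters D) m) (fun k v => v ∈ descendants (clusters D) (m * k) {0}) {0}
    (fun k v => Subtype.val ⁻¹' cells E n (m * k) v) (r := (n : ℝ)⁻¹ ^ m) (c := (n : ℝ)⁻¹ ^ m)
    (C := d * (2 * B + 1) + 1) (pow_pos hρ0 m) (pow_lt_one₀ hρ0.le hρ1 (by omega)) (pow_pos hρ0 m)
    hCpos (mem_descendants_zero.2 rfl) hlev
    (by
      rw [mul_zero, cells_zero_singleton]
      exact Subtype.coe_preimage_self E)
    (fun k v _ => (isCompact_cells hE.2.1 _ v).isClosed.preimage continuous_subtype_val)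
    (fun k v hv => by
      obtain ⟨p, hp⟩ := nonempty_of_mem_descendants (Finset.singleton_nonempty 0) hv
      obtain ⟨z, hz⟩ := hE.1
      have hx : (WithLp.toLp 2 fun i => (p i + z i) / n ^ (m * k)) ∈ cells E n (m * k) v :=
        ⟨p, hp, z, hz, fun _ => rfl⟩
      exact ⟨⟨_, hsub _ v hv hx⟩, hx⟩)
    (fun k v _ => by
      rw [cells_eq_iUnion_descendants hn hE (m * k) m v]
      simp only [Set.preimage_iUnion]
      rfl)
    (fun k v hv x hx y hy => by
      obtain ⟨t, ht⟩ := hB _ v hv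
      obtain ⟨p, hp, z, hz, hx⟩ := hx
      obtain ⟨q, hq, w, hw, hy⟩ := hy
      have hnk : (0 : ℝ) < n ^ (m * k) := by positivity
      rw [← pow_mul, inv_pow]
      rcases Nat.eq_zero_or_pos d with rfl | hd
      · have : x = y := Subtype.ext (Subsingleton.elim _ _)
        rw [this, dist_self]
        positivity
      have hB0' : (0 : ℝ) ≤ B := by
        exact_mod_cast (abs_nonneg _).trans (ht p hp ⟨0, hd⟩)
      have h1 : dist x y ≤ d * ((2 * B + 1) * ((n : ℝ) ^ (m * k))⁻¹) := by
        refine dist_le_of_abs_le (by positivity) fun i => ?_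
        rw [hx, hy, ← sub_div, abs_div, abs_of_pos hnk, div_eq_mul_inv]
        refine mul_le_mul_of_nonneg_right ?_ (inv_pos.2 hnk).le
        have h2 : |((p i - t i : ℤ) : ℝ)| ≤ B := by exact_mod_cast ht p hp i
        have h3 : |((q i - t i : ℤ) : ℝ)| ≤ B := by exact_mod_cast ht q hq i
        push_cast at h2 h3
        rw [abs_le] at h2 h3 ⊢
        have h4 := attractor_subset_unit_cube hn hE hz i
        have h5 := attractor_subset_unit_cube hn hE hw i
        constructor <;> linarith
      refine h1.trans ?_
      rw [← mul_assoc]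
      exact mul_le_mul_of_nonneg_right (by linarith) (inv_pos.2 hnk).le)
    (fun k v hv u hu w hw huw x hx y hy => by
      rw [← pow_mul, ← pow_add, show m + m * k = m * (k + 1) by ring]
      refine inv_pow_le_dist_of_not_near hn hE (fun p hp q hq hpq => huw ?_) hx hy
      exact eq_of_near_of_mem_descendants (hlev k v u hv hu) (hlev k v w hv hw) hp hq hpq)
    (N ^ m) N (Nat.le_self_pow (by omega) N) A
    (hA1 {0} ((hgood _).2 ⟨0, mem_descendants_zero.2 rfl⟩) (by simp [hwt]))
    (fun k v b hv hb => hA v b ((hgood v).2 ⟨_, hv⟩) hb)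
  exact hasCoding_of_restricted hm hρ0 hρ1 (pow_pos hρ0 m) (mul_pos hCpos (inv_pos.2 (pow_pos hρ0 m)))
    Q₀ hQ₀ e hinj hrange hdist

end Bounded

theorem hasCoding_fractalCube {d n : ℕ} (hn : 2 ≤ n) (D : Finset (Fin d → Fin n))
    (hD : D.Nonempty) (hE : IsTotallyDisconnected (fractalCube hn D hD)) (hcard : 2 ≤ D.card) :
    HasCoding (fractalCube hn D hD) D.card :=
  hasCoding_attractor hn (existsUnique_isAttractor_cubeMap hn D hD).choose_spec.1 hE hcard

/-! ### Classification -/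

theorem theorem1p1 {d d' n n' N N' : ℕ} (hn : 2 ≤ n) (hn' : 2 ≤ n')
    (D : Finset (Fin d → Fin n)) (D' : Finset (Fin d' → Fin n'))
    (hD : D.Nonempty) (hD' : D'.Nonempty)
    (hDN : D.card = N) (hDN' : D'.card = N') (hN : 2 ≤ N) (hN' : 2 ≤ N')
    (hE : IsTotallyDisconnected (fractalCube hn D hD))
    (hF : IsTotallyDisconnected (fractalCube hn' D' hD')) :
    StrictlyHolderEquivalent (fractalCube hn D hD) (fractalCube hn' D' hD') ↔
      ∃ q : ℚ, Real.log N / Real.log N' = (q : ℝ) := by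
  have hX := hasCoding_fractalCube hn D hD hE (hDN ▸ hN)
  have hY := hasCoding_fractalCube hn' D' hD' hF (hDN' ▸ hN')
  rw [hDN] at hX
  rw [hDN'] at hY
  have hlog : 0 < Real.log N := Real.log_pos (by exact_mod_cast hN)
  have hlog' : 0 < Real.log N' := Real.log_pos (by exact_mod_cast hN')
  constructor
  · intro h
    obtain ⟨i, j, hi, hij⟩ := hX.exists_pow_eq_pow (by omega) (by omega) hY h
    have h1 : (i : ℝ) * Real.log N = j * Real.log N' := by
      rw [← Real.log_pow, ← Real.log_pow]
      exact_mod_cast congrArg (fun a : ℕ => Real.log a) hij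
    have hi0 : (i : ℝ) ≠ 0 := by
      have : i ≠ 0 := by omega
      exact_mod_cast this
    refine ⟨(j : ℚ) / i, ?_⟩
    push_cast
    rw [div_eq_div_iff hlog'.ne' hi0]
    linarith
  · rintro ⟨q, hq⟩
    have hq0 : (0 : ℝ) < q := hq ▸ div_pos hlog hlog'
    have hnum : 0 < q.num := Rat.num_pos.2 (by exact_mod_cast hq0)
    obtain ⟨a, ha⟩ := Int.eq_ofNat_of_zero_le hnum.le
    have ha0 : 0 < a := by omega
    have hpow : N ^ q.den = N' ^ a := by
      have hden : (0 : ℝ) < q.den := by exact_mod_cast q.den_pos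
      have hqa : (q : ℝ) = a / q.den := by
        rw [Rat.cast_def, ha]
        simp
      rw [hqa, div_eq_div_iff hlog'.ne' hden.ne'] at hq
      have h1 : Real.log ((N : ℝ) ^ q.den) = Real.log ((N' : ℝ) ^ a) := by
        rw [Real.log_pow, Real.log_pow]
        linarith
      have h2 := Real.log_injOn_pos (Set.mem_Ioi.2 (by positivity))
        (Set.mem_Ioi.2 (by positivity)) h1
      exact_mod_cast h2
    have hX' := hX.pow q.den_pos
    rw [hpow] at hX'
    exact hX'.strictlyHolderEquivalent (hY.pow ha0)
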